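/- Let $\mathbb{I}=[-1,1]$ and let $\|\cdot\|_p$ be the norm of the real space $L_p=L_p(\mathbb{I})$. For $r\in\mathbb{N}$ let $L_2^r$ be the set of functions $f:\mathbb{I}\to\mathbb{R}$ whose derivative $f^{(r-1)}$ exists and is absolutely continuous on $\mathbb{I}$ (derivatives at the endpoints being one-sided) and for which $f^{(r)}\in L_2$. Let $W_2^r=\{f\in L_2^r:\|f^{(r)}\|_2\le 1\}$. For $0\le k\le r-1$ and $\delta\ge 0$ put \[ \Omega(\delta)=\sup\{\|f^{(k)}\|_\infty: f\in W_2^r,\ \|f\|_2\le\delta\},\qquad \Omega_{-1}(\delta)=\sup\{|f^{(k)}(-1)|: f\in W_2^r,\ \|f\|_2\le\delta\}, \] and, for a set $\mathscr{R}$ of mappings $S:L_2\to L_\infty$, \[ \mathcal{E}_\delta(\mathscr{R})=\inf_{S\in\mathscr{R}}\ \sup\{\|f^{(k)}-Sy\|_\infty: f\in W_2^r,\ y\in L_2,\ \|f-y\|_2\le\delta\}. \] Theorem. Let either $r=1$ and $k=0$, or $r=2$ and $k\in\{0,1\}$. Let $\mathscr{R}$ be either the set of all linear operators from $L_2$ to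 $L_\infty$ or the set of all mappings from $L_2$ to $L_\infty$. Then, for every $\delta\ge 0$, \[ \Omega(\delta)=\mathcal{E}_\delta(\mathscr{R})=\Omega_{-1}(\delta), \] and this common value is finite. -/

import Mathlib

open MeasureTheory
open scoped ENNReal NNReal

noncomputable section

namespace LandauKolmogorov

/-- The interval `𝕀 = [-1, 1]`. -/
abbrev I : Set ℝ := Set.Icc (-1) 1

/-- Lebesgue measure on `𝕀 = [-1, 1]`. -/
abbrev μI : Measure ℝ := volume.restrict I

/-- The `j`-th derivative of `f` on `𝕀` (one-sided at the endpoints). It only depends on the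
values of `f` on `𝕀`. -/
abbrev D (j : ℕ) (f : ℝ → ℝ) : ℝ → ℝ := iteratedDerivWithin j f I

/-- `f` belongs to `L_2^r`, `r ≥ 1`: the derivative `f^{(r-1)}` exists everywhere on `𝕀` and is
absolutely continuous there, and the (almost everywhere defined) derivative `f^{(r)}` is in
`L_2(𝕀)`. -/
structure MemL2r (r : ℕ) (f : ℝ → ℝ) : Prop where
  contDiffOn : ContDiffOn ℝ ((r - 1 : ℕ) : WithTop ℕ∞) f I
  absolutelyContinuous : AbsolutelyContinuousOnInterval (D (r - 1) f) (-1) 1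
  memLp : MemLp (D r f) 2 μI

/-- The class `W^r_2` of all `f ∈ L_2^r` with `‖f^{(r)}‖₂ ≤ 1`. -/
def W (r : ℕ) : Set (ℝ → ℝ) := {f | MemL2r r f ∧ eLpNorm (D r f) 2 μI ≤ 1}

/-- The modulus of continuity of the operator `D^k : L_2 → L_∞` on `W^r_2`:
`Ω(δ) = sup {‖f^{(k)}‖_∞ : f ∈ W^r_2, ‖f‖₂ ≤ δ}`. -/
def modulus (r k : ℕ) (δ : ℝ≥0) : ℝ≥0∞ :=
  ⨆ (f : ℝ → ℝ) (_ : f ∈ W r) (_ : eLpNorm f 2 μI ≤ δ), eLpNorm (D k f) ∞ μI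

/-- The modulus of continuity of the functional `D^k_t : L_2 → ℝ` on `W^r_2`:
`Ω_t(δ) = sup {|f^{(k)}(t)| : f ∈ W^r_2, ‖f‖₂ ≤ δ}`. -/
def pointModulus (r k : ℕ) (t : ℝ) (δ : ℝ≥0) : ℝ≥0∞ :=
  ⨆ (f : ℝ → ℝ) (_ : f ∈ W r) (_ : eLpNorm f 2 μI ≤ δ), ENNReal.ofReal |D k f t|

/-- The real Banach space `L_p(𝕀)`. -/
abbrev LI (p : ℝ≥0∞) := Lp ℝ p μI

/-- The error of the recovery method `S : L_2 → L_∞`: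
`U_δ(D^k; S; W^r_2) = sup {‖f^{(k)} - S y‖_∞ : f ∈ W^r_2, y ∈ L_2, ‖f - y‖₂ ≤ δ}`. -/
def recoveryErrorOf (r k : ℕ) (δ : ℝ≥0) (S : LI 2 → LI ∞) : ℝ≥0∞ :=
  ⨆ (f : ℝ → ℝ) (_ : f ∈ W r) (y : LI 2) (_ : eLpNorm (fun x => f x - y x) 2 μI ≤ δ),
    eLpNorm (fun x => D k f x - S y x) ∞ μI

/-- The error of optimal recovery of `D^k` on `W^r_2` by the methods in the set `R`:
`ℰ_δ(R; D^k; W^r_2) = inf_{S ∈ R} U_δ(D^k; S; W^r_2)`. -/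
def recoveryError (R : Set (LI 2 → LI ∞)) (r k : ℕ) (δ : ℝ≥0) : ℝ≥0∞ :=
  ⨅ S ∈ R, recoveryErrorOf r k δ S

/-- The set of all mappings from `L_2` to `L_∞`. -/
def allMaps : Set (LI 2 → LI ∞) := Set.univ

/-- The set of all linear operators from `L_2` to `L_∞`. -/
def linearMaps : Set (LI 2 → LI ∞) := {S | IsLinearMap ℝ S}

end LandauKolmogorov

end

noncomputable section

namespace LandauKolmogorov

open Real

/-! ### Hyperbolic and trigonometric inequalities -/

/-! The equalities come from a cycle: `Ω` ≤ error over `R` ≤ error over linear operators ≤ `Ω₋₁` ≤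
`Ω`. The first inequality tests a method on the datum `0`, which is compatible with both `f` and
`-f`. The second is inclusion of classes, and the last is continuity of `f^{(k)}`. The content is
the third: a linear method whose error is at most the modulus at the endpoint, up to `ε`.

Duality. Separating a convex set of energy pairs from a quadrant (`exists_endpointBound`) turns the
value `M` of the endpoint modulus into an inequality `f^{(k)}(-1)² ≤ A‖f‖² + B‖f^{(r)}‖²`, valid on
all of `L_2^r`, with `Aδ² + B ≤ M² + ε`.

Domination. For `r ≤ 2` the same inequality holds at every `t` (`EndpointDominates`). The least
energy on `[-1,t]` and on `[t,1]` with given data at `t` and free outer ends is bounded below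
through an explicit solution of a Riccati equation. For `r = 2`, with `A = 4κ⁴B`, the sum of the two
quadratic forms has a determinant which, apart from its denominators, does not depend on `t`.
Minimizing over the datum not being estimated leaves a bound that is weakest at the ends, by the
mixed hyperbolic-trigonometric inequalities. An explicit extremal function shows that the endpoint
inequality already forces `B` to be large enough for this bound.

Recovery. The inequality at all `t` says that `f ↦ f^{(k)}` into `L_∞` is a contraction relative to
`f ↦ (√A f, √B f^{(r)})` into a Hilbert space. It extends to a contraction `G` of the whole space
(`exists_contraction_extension`), and `S y = G(√A y, 0)` is the required method. -/

lemma cosh_sub_cos_nonneg (x : ℝ) : 0 ≤ cosh x - cos x := by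
  linarith [one_le_cosh x, cos_le_one x]

/-- The quadratic Taylor terms cancel: `cosh x = 1 + 2 sinh²(x/2) ≥ 1 + x²/2`, while `cos x ≥ 1 -
x²/2`. -/
lemma cosh_add_cos_ge_two (x : ℝ) : 2 ≤ cosh x + cos x := by
  have hq : |x / 2| ≤ |sinh (x / 2)| := by
    rcases le_total 0 (x / 2) with h | h
    · rw [abs_of_nonneg h, abs_of_nonneg (sinh_nonneg_iff.2 h)]
      exact self_le_sinh_iff.2 h
    · rw [abs_of_nonpos h, abs_of_nonpos (sinh_nonpos_iff.2 h)]
      linarith [sinh_le_self_iff.2 h]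
  have h2 := sq_le_sq.2 hq
  have h3 : cosh x = 1 + 2 * sinh (x / 2) ^ 2 := by
    have := cosh_two_mul (x / 2)
    rw [show 2 * (x / 2) = x by ring] at this
    rw [this, cosh_sq]; ring
  have h4 := one_sub_sq_div_two_le_cos (x := x)
  nlinarith

lemma cosh_add_cos_gt_two {x : ℝ} (hx : 0 < x) : 2 < cosh x + cos x := by
  have h1 : x / 2 < sinh (x / 2) := self_lt_sinh_iff.2 (by positivity)
  have h3 : cosh x = 1 + 2 * sinh (x / 2) ^ 2 := by
    have := cosh_two_mul (x / 2)
    rw [show 2 * (x / 2) = x by ring] at this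
    rw [this, cosh_sq]; ring
  have h4 := one_sub_sq_div_two_le_cos (x := x)
  nlinarith

lemma sinh_add_sin_nonneg {x : ℝ} (hx : 0 ≤ x) : 0 ≤ sinh x + sin x := by
  have h1 := self_le_sinh_iff.2 hx
  have h2 := neg_abs_le (sin x)
  have h3 := abs_sin_le_abs (x := x)
  rw [abs_of_nonneg hx] at h3
  linarith

lemma sinh_sub_sin_nonneg {x : ℝ} (hx : 0 ≤ x) : 0 ≤ sinh x - sin x := by
  linarith [self_le_sinh_iff.2 hx, sin_le hx]

lemma sinh_add_sin_pos {x : ℝ} (hx : 0 < x) : 0 < sinh x + sin x := by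
  have h1 := self_lt_sinh_iff.2 hx
  have h2 := neg_abs_le (sin x)
  have h3 := abs_sin_le_abs (x := x)
  rw [abs_of_nonneg hx.le] at h3
  linarith

lemma sinh_sub_sin_pos {x : ℝ} (hx : 0 < x) : 0 < sinh x - sin x := by
  linarith [self_lt_sinh_iff.2 hx, sin_le hx.le]

/-- After the addition formulas, the difference of the sides is a nonnegative combination of the
four products `h1`–`h4`. It vanishes for `x = 0` or `y = 0`, which is why the endpoints will be the
worst points. -/
lemma sinh_add_sin_mixed_le {x y : ℝ} (hx : 0 ≤ x) (hy : 0 ≤ y) :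
    (sinh x + sin x) * (cosh y + cos y + 2) + (sinh y + sin y) * (cosh x + cos x + 2)
      ≤ 4 * (sinh (x + y) + sin (x + y)) := by
  have h1 := mul_nonneg (sinh_add_sin_nonneg hy) (sub_nonneg.2 (cosh_add_cos_ge_two x))
  have h2 := mul_nonneg (sinh_add_sin_nonneg hx) (sub_nonneg.2 (cosh_add_cos_ge_two y))
  have h3 := mul_nonneg (sinh_sub_sin_nonneg hy) (cosh_sub_cos_nonneg x)
  have h4 := mul_nonneg (sinh_sub_sin_nonneg hx) (cosh_sub_cos_nonneg y)
  rw [sinh_add, sin_add]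
  linarith

lemma sinh_sub_sin_mixed_le {x y : ℝ} (hx : 0 ≤ x) (hy : 0 ≤ y) :
    (sinh x - sin x) * (cosh y + cos y + 2) + (sinh y - sin y) * (cosh x + cos x + 2)
      ≤ 4 * (sinh (x + y) - sin (x + y)) := by
  have h1 := mul_nonneg (sinh_sub_sin_nonneg hy) (sub_nonneg.2 (cosh_add_cos_ge_two x))
  have h2 := mul_nonneg (sinh_sub_sin_nonneg hx) (sub_nonneg.2 (cosh_add_cos_ge_two y))
  have h3 := mul_nonneg (sinh_add_sin_nonneg hy) (cosh_sub_cos_nonneg x)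
  have h4 := mul_nonneg (sinh_add_sin_nonneg hx) (cosh_sub_cos_nonneg y)
  rw [sinh_add, sin_add]
  linarith

/-- Keeps the endpoint constants bounded for large `κ`; it serves the `EndpointSmall` lemmas. -/
lemma sinh_le_two_mul_cosh_add_cos {z : ℝ} (hz : 4 ≤ z) :
    sinh z + 1 ≤ 2 * (cosh z + cos z - 2) := by
  have h1 : sinh z ≤ cosh z := (sinh_lt_cosh z).le
  have h3 : cosh z = 1 + 2 * sinh (z / 2) ^ 2 := by
    have := cosh_two_mul (z / 2)
    rw [show 2 * (z / 2) = z by ring] at this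
    rw [this, cosh_sq]; ring
  have h2 : z / 2 ≤ sinh (z / 2) := self_le_sinh_iff.2 (by linarith)
  have h4 := neg_one_le_cos z
  nlinarith

/-! ### Solution of the Riccati system -/

/-- The denominator of the solution of the Riccati system. -/
def ricD (y : ℝ) : ℝ := cosh (2 * y) + cos (2 * y) + 2

/-- The coefficient of `f²` in the solution of the Riccati system. -/
def ricA (y : ℝ) : ℝ := 4 * (sinh (2 * y) + sin (2 * y)) / ricD y

/-- The coefficient of `2 f f'` in the solution of the Riccati system. -/
def ricB (y : ℝ) : ℝ := -2 * (cosh (2 * y) - cos (2 * y)) / ricD y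

/-- The coefficient of `(f')²` in the solution of the Riccati system. -/
def ricC (y : ℝ) : ℝ := 2 * (sinh (2 * y) - sin (2 * y)) / ricD y

lemma ricD_pos (y : ℝ) : 0 < ricD y := by
  have := cosh_add_cos_ge_two (2 * y); unfold ricD; linarith

lemma ricA_neg (y : ℝ) : ricA (-y) = -ricA y := by
  simp only [ricA, ricD, mul_neg, sinh_neg, cosh_neg, sin_neg, cos_neg]; ring

lemma ricB_neg (y : ℝ) : ricB (-y) = ricB y := by
  simp only [ricB, ricD, mul_neg, cosh_neg, cos_neg]

lemma ricC_neg (y : ℝ) : ricC (-y) = -ricC y := by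
  simp only [ricC, ricD, mul_neg, sinh_neg, cosh_neg, sin_neg, cos_neg]; ring

lemma hasDerivAt_two_mul (y : ℝ) : HasDerivAt (fun y : ℝ => 2 * y) 2 y := by
  simpa using (hasDerivAt_id y).const_mul 2

lemma hasDerivAt_ricD (y : ℝ) :
    HasDerivAt ricD (2 * (sinh (2 * y) - sin (2 * y))) y := by
  have h := hasDerivAt_two_mul y
  refine ((h.cosh.add h.cos).add_const 2).congr_deriv ?_
  ring

/-- This and the next two formulas form a Riccati system. It says exactly that `C g'² + 2B g g' + A
g²` has derivative `g''² + 4g² - (g'' - B g - C g')²` along any `g`. -/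
lemma hasDerivAt_ricA (y : ℝ) : HasDerivAt ricA (4 - ricB y ^ 2) y := by
  have h := hasDerivAt_two_mul y
  have hD := (ricD_pos y).ne'
  refine (((h.sinh.add h.sin).const_mul 4).div (hasDerivAt_ricD y) hD).congr_deriv ?_
  have h1 := cosh_sq (2 * y)
  have h2 := sin_sq_add_cos_sq (2 * y)
  simp only [ricB, Pi.add_apply]
  field_simp
  unfold ricD
  linear_combination 8 * h1 + 8 * h2

lemma hasDerivAt_ricB (y : ℝ) : HasDerivAt ricB (-ricA y - ricB y * ricC y) y := by
  have h := hasDerivAt_two_mul y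
  have hD := (ricD_pos y).ne'
  refine (((h.cosh.sub h.cos).const_mul (-2)).div (hasDerivAt_ricD y) hD).congr_deriv ?_
  simp only [ricA, ricB, ricC, Pi.sub_apply]
  field_simp
  ring

lemma hasDerivAt_ricC (y : ℝ) : HasDerivAt ricC (-2 * ricB y - ricC y ^ 2) y := by
  have h := hasDerivAt_two_mul y
  have hD := (ricD_pos y).ne'
  refine (((h.sinh.sub h.sin).const_mul 2).div (hasDerivAt_ricD y) hD).congr_deriv ?_
  simp only [ricB, ricC, Pi.sub_apply]
  field_simp

/-- With `y₁ = κ(1 + t)` and `y₂ = κ(1 - t)` the right-hand side is independent of `t`. The sign in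
`ricB y₁ - ricB y₂` reflects that reversing the interval changes the sign of `f'`. -/
lemma ric_det (y₁ y₂ : ℝ) :
    ((ricA y₁ + ricA y₂) * (ricC y₁ + ricC y₂) - (ricB y₁ - ricB y₂) ^ 2) * (ricD y₁ * ricD y₂)
      = 16 * (cosh (2 * y₁ + 2 * y₂) + cos (2 * y₁ + 2 * y₂) - 2) := by
  have hD1 := (ricD_pos y₁).ne'
  have hD2 := (ricD_pos y₂).ne'
  have h1 := cosh_sq (2 * y₁)
  have h2 := sin_sq_add_cos_sq (2 * y₁)
  have h3 := cosh_sq (2 * y₂)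
  have h4 := sin_sq_add_cos_sq (2 * y₂)
  rw [cosh_add, cos_add]
  simp only [ricA, ricB, ricC]
  field_simp
  unfold ricD
  generalize cosh (2 * y₁) = C₁ at *
  generalize sinh (2 * y₁) = S₁ at *
  generalize cos (2 * y₁) = c₁ at *
  generalize sin (2 * y₁) = s₁ at *
  generalize cosh (2 * y₂) = C₂ at *
  generalize sinh (2 * y₂) = S₂ at *
  generalize cos (2 * y₂) = c₂ at *
  generalize sin (2 * y₂) = s₂ at *
  have e1 : S₁ ^ 2 = C₁ ^ 2 - 1 := by linarith
  have e2 : s₁ ^ 2 = 1 - c₁ ^ 2 := by linarith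
  have e3 : S₂ ^ 2 = C₂ ^ 2 - 1 := by linarith
  have e4 : s₂ ^ 2 = 1 - c₂ ^ 2 := by linarith
  linear_combination (8 * (C₂ + c₂ + 2) ^ 2) * (e1 - e2) + (8 * (C₁ + c₁ + 2) ^ 2) * (e3 - e4)

/-- Completing the square in `q` leaves (determinant)/(coefficient of `q²`) times `p²`. The
determinant is `ric_det`, and the coefficient is controlled by `sinh_add_sin_mixed_le`. -/
lemma ric_form_ge_slope {y₁ y₂ : ℝ} (h₁ : 0 ≤ y₁) (h₂ : 0 ≤ y₂) (h : 0 < y₁ + y₂) (p q : ℝ) :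
    (cosh (2 * y₁ + 2 * y₂) + cos (2 * y₁ + 2 * y₂) - 2) * p ^ 2 ≤
      (sinh (2 * y₁ + 2 * y₂) + sin (2 * y₁ + 2 * y₂)) *
        ((ricC y₁ + ricC y₂) * p ^ 2 + 2 * (ricB y₁ - ricB y₂) * p * q
          + (ricA y₁ + ricA y₂) * q ^ 2) := by
  have hS := sinh_add_sin_mixed_le (x := 2 * y₁) (y := 2 * y₂) (by linarith) (by linarith)
  have hZ := sinh_add_sin_pos (x := 2 * y₁ + 2 * y₂) (by linarith)
  have hdet := ric_det y₁ y₂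
  have hE := cosh_add_cos_ge_two (2 * y₁ + 2 * y₂)
  have hDD := mul_pos (ricD_pos y₁) (ricD_pos y₂)
  have hA : (ricA y₁ + ricA y₂) * (ricD y₁ * ricD y₂) =
      4 * ((sinh (2 * y₁) + sin (2 * y₁)) * ricD y₂ + (sinh (2 * y₂) + sin (2 * y₂)) * ricD y₁) := by
    have hD1 := (ricD_pos y₁).ne'
    have hD2 := (ricD_pos y₂).ne'
    simp only [ricA]; field_simp
  have hApos : 0 < ricA y₁ + ricA y₂ := by
    refine pos_of_mul_pos_left (b := ricD y₁ * ricD y₂) ?_ hDD.le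
    rw [hA]
    have e1 := sinh_add_sin_nonneg (x := 2 * y₁) (by linarith)
    have e2 := sinh_add_sin_nonneg (x := 2 * y₂) (by linarith)
    have f1 := mul_nonneg e1 (ricD_pos y₂).le
    have f2 := mul_nonneg e2 (ricD_pos y₁).le
    rcases h₁.lt_or_eq with h' | h'
    · have := mul_pos (sinh_add_sin_pos (x := 2 * y₁) (by linarith)) (ricD_pos y₂)
      linarith
    · have := mul_pos (sinh_add_sin_pos (x := 2 * y₂) (by linarith)) (ricD_pos y₁)
      linarith
  change (sinh (2 * y₁) + sin (2 * y₁)) * ricD y₂ + (sinh (2 * y₂) + sin (2 * y₂)) * ricD y₁ ≤ _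
    at hS
  generalize cosh (2 * y₁ + 2 * y₂) + cos (2 * y₁ + 2 * y₂) = E at *
  generalize sinh (2 * y₁ + 2 * y₂) + sin (2 * y₁ + 2 * y₂) = S at *
  generalize ricA y₁ + ricA y₂ = a at *
  generalize ricB y₁ - ricB y₂ = b at *
  generalize ricC y₁ + ricC y₂ = c at *
  generalize ricD y₁ * ricD y₂ = d at *
  have hadS : a * d ≤ 16 * S := by linarith
  refine le_of_mul_le_mul_left ?_ (mul_pos hApos hDD)
  have key : a * (c * p ^ 2 + 2 * b * p * q + a * q ^ 2) = (a * q + b * p) ^ 2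
      + (a * c - b ^ 2) * p ^ 2 := by ring
  calc a * d * ((E - 2) * p ^ 2) ≤ 16 * S * ((E - 2) * p ^ 2) := by
        gcongr
    _ = S * ((a * c - b ^ 2) * d * p ^ 2) := by rw [hdet]; ring
    _ ≤ S * (d * (a * q + b * p) ^ 2 + (a * c - b ^ 2) * d * p ^ 2) := by
        gcongr
        have := mul_nonneg hDD.le (sq_nonneg (a * q + b * p))
        linarith
    _ = a * d * (S * (c * p ^ 2 + 2 * b * p * q + a * q ^ 2)) := by
        linear_combination (-S * d) * key

/-- The same argument with the square completed in `p` and `sinh_sub_sin_mixed_le` bounding the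
coefficient of `p²`. -/
lemma ric_form_ge_value {y₁ y₂ : ℝ} (h₁ : 0 ≤ y₁) (h₂ : 0 ≤ y₂) (h : 0 < y₁ + y₂) (p q : ℝ) :
    2 * (cosh (2 * y₁ + 2 * y₂) + cos (2 * y₁ + 2 * y₂) - 2) * q ^ 2 ≤
      (sinh (2 * y₁ + 2 * y₂) - sin (2 * y₁ + 2 * y₂)) *
        ((ricC y₁ + ricC y₂) * p ^ 2 + 2 * (ricB y₁ - ricB y₂) * p * q
          + (ricA y₁ + ricA y₂) * q ^ 2) := by
  have hS := sinh_sub_sin_mixed_le (x := 2 * y₁) (y := 2 * y₂) (by linarith) (by linarith)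
  have hZ := sinh_sub_sin_pos (x := 2 * y₁ + 2 * y₂) (by linarith)
  have hdet := ric_det y₁ y₂
  have hE := cosh_add_cos_ge_two (2 * y₁ + 2 * y₂)
  have hDD := mul_pos (ricD_pos y₁) (ricD_pos y₂)
  have hC : (ricC y₁ + ricC y₂) * (ricD y₁ * ricD y₂) =
      2 * ((sinh (2 * y₁) - sin (2 * y₁)) * ricD y₂ + (sinh (2 * y₂) - sin (2 * y₂)) * ricD y₁) := by
    have hD1 := (ricD_pos y₁).ne'
    have hD2 := (ricD_pos y₂).ne'
    simp only [ricC]; field_simp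
  have hCpos : 0 < ricC y₁ + ricC y₂ := by
    refine pos_of_mul_pos_left (b := ricD y₁ * ricD y₂) ?_ hDD.le
    rw [hC]
    have e1 := sinh_sub_sin_nonneg (x := 2 * y₁) (by linarith)
    have e2 := sinh_sub_sin_nonneg (x := 2 * y₂) (by linarith)
    have f1 := mul_nonneg e1 (ricD_pos y₂).le
    have f2 := mul_nonneg e2 (ricD_pos y₁).le
    rcases h₁.lt_or_eq with h' | h'
    · have := mul_pos (sinh_sub_sin_pos (x := 2 * y₁) (by linarith)) (ricD_pos y₂)
      linarith
    · have := mul_pos (sinh_sub_sin_pos (x := 2 * y₂) (by linarith)) (ricD_pos y₁)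
      linarith
  change (sinh (2 * y₁) - sin (2 * y₁)) * ricD y₂ + (sinh (2 * y₂) - sin (2 * y₂)) * ricD y₁ ≤ _
    at hS
  generalize cosh (2 * y₁ + 2 * y₂) + cos (2 * y₁ + 2 * y₂) = E at *
  generalize sinh (2 * y₁ + 2 * y₂) - sin (2 * y₁ + 2 * y₂) = S at *
  generalize ricA y₁ + ricA y₂ = a at *
  generalize ricB y₁ - ricB y₂ = b at *
  generalize ricC y₁ + ricC y₂ = c at *
  generalize ricD y₁ * ricD y₂ = d at *
  have hcdS : c * d ≤ 8 * S := by linarith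
  refine le_of_mul_le_mul_left ?_ (mul_pos hCpos hDD)
  have key : c * (c * p ^ 2 + 2 * b * p * q + a * q ^ 2) = (c * p + b * q) ^ 2
      + (a * c - b ^ 2) * q ^ 2 := by ring
  calc c * d * (2 * (E - 2) * q ^ 2) ≤ 8 * S * (2 * (E - 2) * q ^ 2) := by
        gcongr
    _ = S * ((a * c - b ^ 2) * d * q ^ 2) := by rw [hdet]; ring
    _ ≤ S * (d * (c * p + b * q) ^ 2 + (a * c - b ^ 2) * d * q ^ 2) := by
        gcongr
        have := mul_nonneg hDD.le (sq_nonneg (c * p + b * q))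
        linarith
    _ = c * d * (S * (c * p ^ 2 + 2 * b * p * q + a * q ^ 2)) := by
        linear_combination (-S * d) * key

/-! ### Regularity of functions in `L_2^r` -/

lemma uniqueDiffOn_I : UniqueDiffOn ℝ I := uniqueDiffOn_Icc (by norm_num)

lemma uIcc_eq_I : Set.uIcc (-1 : ℝ) 1 = I := Set.uIcc_of_le (by norm_num)

lemma D_zero (f : ℝ → ℝ) : D 0 f = f := iteratedDerivWithin_zero

lemma MemL2r.continuousOn {r j : ℕ} {f : ℝ → ℝ} (hf : MemL2r r f) (hj : j < r) :
    ContinuousOn (D j f) I :=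
  hf.contDiffOn.continuousOn_iteratedDerivWithin
    (by exact_mod_cast (by omega : j ≤ r - 1)) uniqueDiffOn_I

lemma MemL2r.absolutelyContinuous_D {r j : ℕ} {f : ℝ → ℝ} (hf : MemL2r r f) (hj : j < r) :
    AbsolutelyContinuousOnInterval (D j f) (-1) 1 := by
  rcases (by omega : j = r - 1 ∨ j + 1 < r) with rfl | h
  · exact hf.absolutelyContinuous
  · apply ContDiffOn.absolutelyContinuousOnInterval
    rw [uIcc_eq_I]
    have hd := hf.contDiffOn
    rw [contDiffOn_nat_iff_continuousOn_differentiableOn_deriv uniqueDiffOn_I] at hd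
    have := (contDiffOn_nat_iff_continuousOn_differentiableOn_deriv (n := 1) (f := D j f)
      uniqueDiffOn_I).2
    norm_cast at this
    refine this ⟨fun m hm => ?_, fun m hm => ?_⟩
    · interval_cases m
      · simpa using hd.1 j (by omega)
      · simpa [iteratedDerivWithin_one, iteratedDerivWithin_succ] using hd.1 (j + 1) (by omega)
    · interval_cases m
      simpa using hd.2 j (by omega)

lemma MemL2r.ae_hasDerivAt {r j : ℕ} {f : ℝ → ℝ} (hf : MemL2r r f) (hj : j < r) :
    ∀ᵐ x : ℝ, x ∈ I → HasDerivAt (D j f) (D (j + 1) f x) x := by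
  have h1 := (hf.absolutelyContinuous_D hj).ae_differentiableAt
  have h2 : ∀ᵐ x : ℝ, x ≠ -1 := by simp [ae_iff, measure_singleton]
  have h3 : ∀ᵐ x : ℝ, x ≠ 1 := by simp [ae_iff, measure_singleton]
  filter_upwards [h1, h2, h3] with x hx hx2 hx3 hxI
  have hn : I ∈ nhds x := Icc_mem_nhds (lt_of_le_of_ne hxI.1 hx2.symm) (lt_of_le_of_ne hxI.2 hx3)
  have hd := hx (by rwa [uIcc_eq_I])
  have : D (j + 1) f x = deriv (D j f) x := by
    simp only [D, iteratedDerivWithin_succ]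
    exact derivWithin_of_mem_nhds hn
  rw [this]
  exact hd.hasDerivAt

lemma MemL2r.memLp_D {r j : ℕ} {f : ℝ → ℝ} (hf : MemL2r r f) (hj : j ≤ r) :
    MemLp (D j f) 2 μI := by
  rcases hj.eq_or_lt with rfl | h
  · exact hf.memLp
  · have hc := hf.continuousOn h
    obtain ⟨C, hC⟩ := isCompact_Icc.exists_bound_of_continuousOn hc
    refine MemLp.of_bound (hc.aestronglyMeasurable measurableSet_Icc) C ?_
    filter_upwards [ae_restrict_mem measurableSet_Icc] with x hx using hC x hx

lemma D_add {r j : ℕ} {f g : ℝ → ℝ} (hf : MemL2r r f) (hg : MemL2r r g) (hj : j < r) {x : ℝ}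
    (hx : x ∈ I) : D j (f + g) x = D j f x + D j g x :=
  have h : ((j : ℕ) : WithTop ℕ∞) ≤ ((r - 1 : ℕ) : WithTop ℕ∞) := by
    exact_mod_cast (by omega : j ≤ r - 1)
  iteratedDerivWithin_add hx uniqueDiffOn_I ((hf.contDiffOn x hx).of_le h)
    ((hg.contDiffOn x hx).of_le h)

lemma D_smul {r j : ℕ} {f : ℝ → ℝ} (c : ℝ) (hf : MemL2r r f) (hj : j < r) {x : ℝ}
    (hx : x ∈ I) : D j (c • f) x = c * D j f x :=
  have h : ((j : ℕ) : WithTop ℕ∞) ≤ ((r - 1 : ℕ) : WithTop ℕ∞) := by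
    exact_mod_cast (by omega : j ≤ r - 1)
  iteratedDerivWithin_const_smul hx uniqueDiffOn_I c ((hf.contDiffOn x hx).of_le h)

lemma D_succ_congr {j : ℕ} {f g : ℝ → ℝ} (h : ∀ x ∈ I, D j f x = g x) {x : ℝ} (hx : x ∈ I) :
    D (j + 1) f x = derivWithin g I x := by
  simp only [D, iteratedDerivWithin_succ]
  exact derivWithin_congr h (h x hx)

/-- Only almost everywhere: for `j + 1 = r` the derivative may fail to exist at some points, where
`derivWithin` takes the default value `0` and need not be additive. -/
lemma D_add_ae {r j : ℕ} {f g : ℝ → ℝ} (hf : MemL2r r f) (hg : MemL2r r g) (hj : j < r) :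
    D (j + 1) (f + g) =ᵐ[μI] D (j + 1) f + D (j + 1) g := by
  rw [Filter.EventuallyEq, ae_restrict_iff' measurableSet_Icc]
  filter_upwards [hf.ae_hasDerivAt hj, hg.ae_hasDerivAt hj] with x h1 h2 hx
  rw [D_succ_congr (fun y hy => D_add hf hg hj hy) hx]
  exact ((h1 hx).add (h2 hx)).hasDerivWithinAt.derivWithin (uniqueDiffOn_I x hx)

lemma D_smul_ae {r j : ℕ} {f : ℝ → ℝ} (c : ℝ) (hf : MemL2r r f) (hj : j < r) :
    D (j + 1) (c • f) =ᵐ[μI] c • D (j + 1) f := by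
  rw [Filter.EventuallyEq, ae_restrict_iff' measurableSet_Icc]
  filter_upwards [hf.ae_hasDerivAt hj] with x h1 hx
  rw [D_succ_congr (fun y hy => D_smul c hf hj hy) hx]
  exact ((h1 hx).const_mul c).hasDerivWithinAt.derivWithin (uniqueDiffOn_I x hx)

lemma absolutelyContinuous_congr {f g : ℝ → ℝ} (h : ∀ x ∈ I, f x = g x)
    (hf : AbsolutelyContinuousOnInterval f (-1) 1) :
    AbsolutelyContinuousOnInterval g (-1) 1 := by
  rw [absolutelyContinuousOnInterval_iff] at hf ⊢
  intro ε hε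
  obtain ⟨δ, hδ, H⟩ := hf ε hε
  refine ⟨δ, hδ, fun E hE hs => ?_⟩
  convert H E hE hs using 1
  refine Finset.sum_congr rfl fun i hi => ?_
  have := hE.1 i hi
  rw [uIcc_eq_I] at this
  rw [h _ this.1, h _ this.2]

lemma MemL2r.add {r : ℕ} (hr : 0 < r) {f g : ℝ → ℝ} (hf : MemL2r r f) (hg : MemL2r r g) :
    MemL2r r (f + g) where
  contDiffOn := hf.contDiffOn.add hg.contDiffOn
  absolutelyContinuous := absolutelyContinuous_congr
    (fun x hx => (D_add hf hg (by omega) hx).symm)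
    (hf.absolutelyContinuous.add hg.absolutelyContinuous)
  memLp := by
    obtain ⟨j, rfl⟩ := Nat.exists_eq_succ_of_ne_zero hr.ne'
    exact (memLp_congr_ae (D_add_ae hf hg j.lt_succ_self)).2 (hf.memLp.add hg.memLp)

lemma MemL2r.smul {r : ℕ} (hr : 0 < r) {f : ℝ → ℝ} (c : ℝ) (hf : MemL2r r f) :
    MemL2r r (c • f) where
  contDiffOn := hf.contDiffOn.const_smul c
  absolutelyContinuous := absolutelyContinuous_congr
    (fun x hx => (D_smul c hf (by omega) hx).symm)
    (hf.absolutelyContinuous.const_mul c)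
  memLp := by
    obtain ⟨j, rfl⟩ := Nat.exists_eq_succ_of_ne_zero hr.ne'
    exact (memLp_congr_ae (D_smul_ae c hf j.lt_succ_self)).2 (hf.memLp.const_smul c)

lemma memL2r_zero {r : ℕ} : MemL2r r (0 : ℝ → ℝ) := by
  have h : ∀ j, D j (0 : ℝ → ℝ) = 0 := by
    intro j
    induction j with
    | zero => exact D_zero _
    | succ j ih =>
      have : D (j + 1) (0 : ℝ → ℝ) = derivWithin (D j 0) I := iteratedDerivWithin_succ
      rw [this, ih]
      exact derivWithin_zero _
  refine ⟨contDiffOn_const, ?_, ?_⟩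
  · rw [h]
    exact (contDiffOn_const (c := (0 : ℝ))).absolutelyContinuousOnInterval
  · rw [h]; exact MemLp.zero

/-- `∫_{-1}^1 (f^{(j)})²`. -/
def N (j : ℕ) (f : ℝ → ℝ) : ℝ := ∫ x in (-1 : ℝ)..1, D j f x ^ 2

lemma N_eq (j : ℕ) (f : ℝ → ℝ) : N j f = ∫ x, D j f x ^ 2 ∂μI := by
  rw [N, intervalIntegral.integral_of_le (by norm_num), ← integral_Icc_eq_integral_Ioc]

lemma N_nonneg (j : ℕ) (f : ℝ → ℝ) : 0 ≤ N j f := by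
  rw [N_eq]; positivity

lemma eLpNorm_two_eq {g : ℝ → ℝ} (hg : MemLp g 2 μI) :
    eLpNorm g 2 μI = ENNReal.ofReal √(∫ x, g x ^ 2 ∂μI) := by
  rw [hg.eLpNorm_eq_integral_rpow_norm (by norm_num) (by norm_num), sqrt_eq_rpow]
  norm_num

lemma MemL2r.eLpNorm_D_le_iff {r j : ℕ} {f : ℝ → ℝ} (hf : MemL2r r f) (hj : j ≤ r) (δ : ℝ≥0) :
    eLpNorm (D j f) 2 μI ≤ δ ↔ N j f ≤ (δ : ℝ) ^ 2 := by
  rw [eLpNorm_two_eq (hf.memLp_D hj), ← N_eq, ENNReal.ofReal_le_iff_le_toReal (by simp),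
    sqrt_le_left (by simp)]
  simp

lemma MemL2r.intervalIntegrable_sq {r j : ℕ} {f : ℝ → ℝ} (hf : MemL2r r f) (hj : j ≤ r)
    {s t : ℝ} (hs : s ∈ I) (ht : t ∈ I) :
    IntervalIntegrable (fun x => D j f x ^ 2) volume s t := by
  have h := (hf.memLp_D hj).integrable_sq
  have h2 : IntervalIntegrable (fun x => D j f x ^ 2) volume (-1) 1 :=
    (intervalIntegrable_iff_integrableOn_Icc_of_le (by norm_num)).2 h
  exact h2.mono_set (by rw [uIcc_eq_I]; exact Set.uIcc_subset_Icc hs ht)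

/-! ### Lower bounds for the energy -/

lemma sub_le_integral_of_ae_hasDerivAt {F F' G : ℝ → ℝ} {s t : ℝ} (hst : s ≤ t)
    (hF : AbsolutelyContinuousOnInterval F s t)
    (hd : ∀ᵐ x : ℝ, x ∈ Set.Icc s t → HasDerivAt F (F' x) x)
    (hG : IntervalIntegrable G volume s t) (hle : ∀ x ∈ Set.Icc s t, F' x ≤ G x) :
    F t - F s ≤ ∫ x in s..t, G x := by
  rw [← hF.integral_deriv_eq_sub]
  refine intervalIntegral.integral_mono_ae_restrict hst hF.intervalIntegrable_deriv hG ?_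
  rw [Filter.EventuallyLE, ae_restrict_iff' measurableSet_Icc]
  filter_upwards [hd] with x hx hxI
  rw [(hx hxI).deriv]
  exact hle x hxI

lemma Icc_subset_I {s t : ℝ} (hs : s ∈ I) (ht : t ∈ I) : Set.Icc s t ⊆ I :=
  Set.Icc_subset_Icc hs.1 ht.2

lemma hasDerivAt_shift (κ p x : ℝ) : HasDerivAt (fun x => κ * (x - p)) κ x := by
  simpa using ((hasDerivAt_id x).sub_const p).const_mul κ

lemma absolutelyContinuous_of_hasDerivAt {F F' : ℝ → ℝ} (hF : ∀ x, HasDerivAt F (F' x) x)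
    (hF' : Continuous F') (s t : ℝ) : AbsolutelyContinuousOnInterval F s t := by
  apply ContDiffOn.absolutelyContinuousOnInterval
  apply ContDiff.contDiffOn
  rw [contDiff_one_iff_deriv]
  refine ⟨fun x => (hF x).differentiableAt, ?_⟩
  rwa [show deriv F = F' from funext fun x => (hF x).deriv]

lemma continuous_ricA : Continuous ricA :=
  continuous_iff_continuousAt.2 fun y => (hasDerivAt_ricA y).continuousAt

lemma continuous_ricB : Continuous ricB :=
  continuous_iff_continuousAt.2 fun y => (hasDerivAt_ricB y).continuousAt

lemma continuous_ricC : Continuous ricC :=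
  continuous_iff_continuousAt.2 fun y => (hasDerivAt_ricC y).continuousAt

/-- The quadratic form of the Riccati equation for the energy `∫ (f'')² + 4κ⁴f²`. -/
def ricForm (κ p : ℝ) (f : ℝ → ℝ) (x : ℝ) : ℝ :=
  κ * ricC (κ * (x - p)) * D 1 f x ^ 2 + 2 * (κ ^ 2 * ricB (κ * (x - p))) * D 1 f x * D 0 f x
    + κ ^ 3 * ricA (κ * (x - p)) * D 0 f x ^ 2

/-- By the Riccati system, rescaled by `κ`, the derivative of the form along `f` is the energy
density minus a square. -/
lemma ricForm_sub_le {f : ℝ → ℝ} (hf : MemL2r 2 f) (κ p : ℝ) {s t : ℝ} (hs : s ∈ I) (ht : t ∈ I)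
    (hst : s ≤ t) :
    ricForm κ p f t - ricForm κ p f s ≤ ∫ x in s..t, (D 2 f x ^ 2 + 4 * κ ^ 4 * D 0 f x ^ 2) := by
  have hsub : Set.uIcc s t ⊆ Set.uIcc (-1) 1 := by
    rw [uIcc_eq_I, Set.uIcc_of_le hst]; exact Icc_subset_I hs ht
  have a0 := (hf.absolutelyContinuous_D (j := 0) (by norm_num)).mono hsub
  have a1 := (hf.absolutelyContinuous_D (j := 1) (by norm_num)).mono hsub
  have dC : ∀ x, HasDerivAt (fun x => κ * ricC (κ * (x - p)))
      (κ * ((-2 * ricB (κ * (x - p)) - ricC (κ * (x - p)) ^ 2) * κ)) x := fun x =>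
    ((hasDerivAt_ricC _).comp x (hasDerivAt_shift κ p x)).const_mul κ
  have dB : ∀ x, HasDerivAt (fun x => 2 * (κ ^ 2 * ricB (κ * (x - p))))
      (2 * (κ ^ 2 * ((-ricA (κ * (x - p)) - ricB (κ * (x - p)) * ricC (κ * (x - p))) * κ))) x :=
    fun x =>
    (((hasDerivAt_ricB _).comp x (hasDerivAt_shift κ p x)).const_mul (κ ^ 2)).const_mul 2
  have dA : ∀ x, HasDerivAt (fun x => κ ^ 3 * ricA (κ * (x - p)))
      (κ ^ 3 * ((4 - ricB (κ * (x - p)) ^ 2) * κ)) x := fun x =>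
    ((hasDerivAt_ricA _).comp x (hasDerivAt_shift κ p x)).const_mul (κ ^ 3)
  have hsh : Continuous fun x : ℝ => κ * (x - p) := by fun_prop
  have cA := continuous_ricA.comp hsh
  have cB := continuous_ricB.comp hsh
  have cC := continuous_ricC.comp hsh
  simp only [Function.comp_def] at cA cB cC
  have aC := absolutelyContinuous_of_hasDerivAt dC (by fun_prop) s t
  have aB := absolutelyContinuous_of_hasDerivAt dB (by fun_prop) s t
  have aA := absolutelyContinuous_of_hasDerivAt dA (by fun_prop) s t
  have hac : AbsolutelyContinuousOnInterval (ricForm κ p f) s t := by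
    have := ((aC.mul (a1.mul a1)).add ((aB.mul a1).mul a0)).add (aA.mul (a0.mul a0))
    refine (congrArg (AbsolutelyContinuousOnInterval · s t) ?_).mp this
    funext x
    simp only [Pi.add_apply, Pi.mul_apply, ricForm]
    ring
  have hint : IntervalIntegrable (fun x => D 2 f x ^ 2 + 4 * κ ^ 4 * D 0 f x ^ 2) volume s t :=
    (hf.intervalIntegrable_sq le_rfl hs ht).add
      ((hf.intervalIntegrable_sq (by norm_num) hs ht).const_mul _)
  refine sub_le_integral_of_ae_hasDerivAt hst hac (F' := fun x =>
    D 2 f x ^ 2 + 4 * κ ^ 4 * D 0 f x ^ 2 - (D 2 f x - κ ^ 2 * ricB (κ * (x - p)) * D 0 f x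
      - κ * ricC (κ * (x - p)) * D 1 f x) ^ 2) ?_ hint ?_
  · filter_upwards [hf.ae_hasDerivAt (j := 0) (by norm_num),
      hf.ae_hasDerivAt (j := 1) (by norm_num)] with x h0 h1 hx
    have d0 := h0 (Icc_subset_I hs ht hx)
    have d1 := h1 (Icc_subset_I hs ht hx)
    refine ((((dC x).mul (d1.pow 2)).add (((dB x).mul d1).mul d0)).add
      ((dA x).mul (d0.pow 2))).congr_deriv ?_
    simp only [Pi.mul_apply, Pi.pow_apply]
    push_cast
    ring
  · intro x _
    have := sq_nonneg (D 2 f x - κ ^ 2 * ricB (κ * (x - p)) * D 0 f x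
      - κ * ricC (κ * (x - p)) * D 1 f x)
    linarith

lemma MemL2r.integral_energy {r : ℕ} {f : ℝ → ℝ} (hf : MemL2r r f) (c : ℝ) :
    ∫ x in (-1 : ℝ)..1, (D r f x ^ 2 + c * D 0 f x ^ 2) = N r f + c * N 0 f := by
  rw [intervalIntegral.integral_add (hf.intervalIntegrable_sq le_rfl (by simp) (by simp))
    ((hf.intervalIntegrable_sq (Nat.zero_le _) (by simp) (by simp)).const_mul _),
    intervalIntegral.integral_const_mul]
  rfl

lemma MemL2r.integral_energy_add {r : ℕ} {f : ℝ → ℝ} (hf : MemL2r r f) (c : ℝ) {t : ℝ}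
    (ht : t ∈ I) :
    (∫ x in (-1 : ℝ)..t, (D r f x ^ 2 + c * D 0 f x ^ 2))
      + ∫ x in t..1, (D r f x ^ 2 + c * D 0 f x ^ 2) = N r f + c * N 0 f := by
  rw [← hf.integral_energy c]
  have h : ∀ {s t : ℝ}, s ∈ I → t ∈ I →
      IntervalIntegrable (fun x => D r f x ^ 2 + c * D 0 f x ^ 2) volume s t := fun hs ht =>
    (hf.intervalIntegrable_sq le_rfl hs ht).add
      ((hf.intervalIntegrable_sq (Nat.zero_le _) hs ht).const_mul _)
  exact intervalIntegral.integral_add_adjacent_intervals (h (by simp) ht) (h ht (by simp))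

lemma ricA_zero : ricA 0 = 0 := by simp [ricA]

lemma ricB_zero : ricB 0 = 0 := by simp [ricB]

lemma ricC_zero : ricC 0 = 0 := by simp [ricC]

/-- `ricForm_sub_le` is applied on `[-1,t]` with the form centred at `-1` and on `[t,1]` with the
form centred at `1`. Each form vanishes at its centre, so no boundary condition on `f` is needed. -/
lemma ricForm_le_energy {f : ℝ → ℝ} (hf : MemL2r 2 f) (κ : ℝ) {t : ℝ} (ht : t ∈ I) :
    κ * ((ricC (κ * (1 + t)) + ricC (κ * (1 - t))) * D 1 f t ^ 2
      + 2 * (ricB (κ * (1 + t)) - ricB (κ * (1 - t))) * D 1 f t * (κ * D 0 f t)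
      + (ricA (κ * (1 + t)) + ricA (κ * (1 - t))) * (κ * D 0 f t) ^ 2)
      ≤ N 2 f + 4 * κ ^ 4 * N 0 f := by
  have h1 := ricForm_sub_le hf κ (-1) (s := -1) (by simp) ht ht.1
  have h2 := ricForm_sub_le hf κ 1 (t := 1) ht (by simp) ht.2
  rw [← hf.integral_energy_add (4 * κ ^ 4) ht]
  have e1 : ricForm κ (-1) f (-1) = 0 := by
    simp [ricForm, ricA_zero, ricB_zero, ricC_zero]
  have e2 : ricForm κ 1 f 1 = 0 := by
    simp [ricForm, ricA_zero, ricB_zero, ricC_zero]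
  rw [e1] at h1
  rw [e2] at h2
  refine le_trans (le_of_eq ?_) (add_le_add h1 h2)
  simp only [ricForm]
  rw [show κ * (t - 1) = -(κ * (1 - t)) by ring, ricA_neg, ricB_neg, ricC_neg,
    show κ * (t - -1) = κ * (1 + t) by ring]
  ring

lemma slope_sq_le_energy {f : ℝ → ℝ} (hf : MemL2r 2 f) {κ : ℝ} (hκ : 0 < κ) {t : ℝ} (ht : t ∈ I) :
    κ * (cosh (4 * κ) + cos (4 * κ) - 2) * D 1 f t ^ 2
      ≤ (sinh (4 * κ) + sin (4 * κ)) * (N 2 f + 4 * κ ^ 4 * N 0 f) := by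
  have h1 := ric_form_ge_slope (y₁ := κ * (1 + t)) (y₂ := κ * (1 - t))
    (mul_nonneg hκ.le (by linarith [ht.1])) (mul_nonneg hκ.le (by linarith [ht.2]))
    (by linarith) (D 1 f t) (κ * D 0 f t)
  rw [show 2 * (κ * (1 + t)) + 2 * (κ * (1 - t)) = 4 * κ by ring] at h1
  have h2 := mul_le_mul_of_nonneg_left (ricForm_le_energy hf κ ht)
    (sinh_add_sin_pos (x := 4 * κ) (by linarith)).le
  have h3 := mul_le_mul_of_nonneg_left h1 hκ.le
  linarith

lemma value_sq_le_energy {f : ℝ → ℝ} (hf : MemL2r 2 f) {κ : ℝ} (hκ : 0 < κ) {t : ℝ} (ht : t ∈ I) :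
    2 * κ ^ 3 * (cosh (4 * κ) + cos (4 * κ) - 2) * D 0 f t ^ 2
      ≤ (sinh (4 * κ) - sin (4 * κ)) * (N 2 f + 4 * κ ^ 4 * N 0 f) := by
  have h1 := ric_form_ge_value (y₁ := κ * (1 + t)) (y₂ := κ * (1 - t))
    (mul_nonneg hκ.le (by linarith [ht.1])) (mul_nonneg hκ.le (by linarith [ht.2]))
    (by linarith) (D 1 f t) (κ * D 0 f t)
  rw [show 2 * (κ * (1 + t)) + 2 * (κ * (1 - t)) = 4 * κ by ring] at h1
  have h2 := mul_le_mul_of_nonneg_left (ricForm_le_energy hf κ ht)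
    (sinh_sub_sin_pos (x := 4 * κ) (by linarith)).le
  have h3 := mul_le_mul_of_nonneg_left h1 hκ.le
  linarith

/-- First-order analogue: `T = κ tanh(κ(x - p))` solves `T' = κ² - T²`, so `T f²` has derivative
`f'² + κ² f² - (f' - T f)²`. -/
lemma tanhForm_sub_le {f : ℝ → ℝ} (hf : MemL2r 1 f) (κ p : ℝ) {s t : ℝ} (hs : s ∈ I) (ht : t ∈ I)
    (hst : s ≤ t) :
    κ * (sinh (κ * (t - p)) / cosh (κ * (t - p))) * D 0 f t ^ 2
      - κ * (sinh (κ * (s - p)) / cosh (κ * (s - p))) * D 0 f s ^ 2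
      ≤ ∫ x in s..t, (D 1 f x ^ 2 + κ ^ 2 * D 0 f x ^ 2) := by
  have hsub : Set.uIcc s t ⊆ Set.uIcc (-1) 1 := by
    rw [uIcc_eq_I, Set.uIcc_of_le hst]; exact Icc_subset_I hs ht
  have a0 := (hf.absolutelyContinuous_D (j := 0) (by norm_num)).mono hsub
  have dT : ∀ x, HasDerivAt (fun x => κ * (sinh (κ * (x - p)) / cosh (κ * (x - p))))
      (κ ^ 2 - (κ * (sinh (κ * (x - p)) / cosh (κ * (x - p)))) ^ 2) x := fun x => by
    have h := hasDerivAt_shift κ p x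
    have hc := (cosh_pos (κ * (x - p))).ne'
    refine ((h.sinh.div h.cosh hc).const_mul κ).congr_deriv ?_
    field_simp
  have cT : Continuous fun x => κ * (sinh (κ * (x - p)) / cosh (κ * (x - p))) :=
    continuous_iff_continuousAt.2 fun x => (dT x).continuousAt
  have aT := absolutelyContinuous_of_hasDerivAt dT (by fun_prop) s t
  have hac := aT.mul (a0.mul a0)
  have hint : IntervalIntegrable (fun x => D 1 f x ^ 2 + κ ^ 2 * D 0 f x ^ 2) volume s t :=
    (hf.intervalIntegrable_sq le_rfl hs ht).add
      ((hf.intervalIntegrable_sq (by norm_num) hs ht).const_mul _)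
  have := sub_le_integral_of_ae_hasDerivAt hst hac (F' := fun x =>
    D 1 f x ^ 2 + κ ^ 2 * D 0 f x ^ 2
      - (D 1 f x - κ * (sinh (κ * (x - p)) / cosh (κ * (x - p))) * D 0 f x) ^ 2) ?_ hint ?_
  · simpa only [Pi.mul_apply, Pi.pow_apply, ← pow_two] using this
  · filter_upwards [hf.ae_hasDerivAt (j := 0) (by norm_num)] with x h0 hx
    have d0 := h0 (Icc_subset_I hs ht hx)
    refine ((dT x).mul (d0.mul d0)).congr_deriv ?_
    simp only [Pi.mul_apply]
    ring
  · intro x _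
    have := sq_nonneg (D 1 f x - κ * (sinh (κ * (x - p)) / cosh (κ * (x - p))) * D 0 f x)
    linarith

lemma value_sq_le_energy_one {f : ℝ → ℝ} (hf : MemL2r 1 f) {κ : ℝ} (hκ : 0 < κ) {t : ℝ}
    (ht : t ∈ I) :
    κ * sinh (2 * κ) * D 0 f t ^ 2 ≤ cosh (2 * κ) * (N 1 f + κ ^ 2 * N 0 f) := by
  have h1 := tanhForm_sub_le hf κ (-1) (s := -1) (by simp) ht ht.1
  have h2 := tanhForm_sub_le hf κ 1 (t := 1) ht (by simp) ht.2
  have h3 := hf.integral_energy_add (κ ^ 2) ht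
  have e : κ * (t - 1) = -(κ * (1 - t)) := by ring
  simp only [sub_self, mul_zero, sinh_zero, zero_div, zero_mul, sub_zero, zero_sub, e, sinh_neg,
    cosh_neg, sub_neg_eq_add] at h1 h2
  have hc1 := cosh_pos (κ * (t + 1))
  have hc2 := cosh_pos (κ * (1 - t))
  -- The sum of the two hyperbolic tangents is `sinh(2κ)` over this product, and equality holds for
  -- `t = ±1`.
  have hle : cosh (κ * (t + 1)) * cosh (κ * (1 - t)) ≤ cosh (2 * κ) := by
    rw [show 2 * κ = κ * (t + 1) + κ * (1 - t) by ring, cosh_add]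
    have := mul_nonneg (sinh_nonneg_iff.2 (mul_nonneg hκ.le (by linarith [ht.1] : 0 ≤ t + 1)))
      (sinh_nonneg_iff.2 (mul_nonneg hκ.le (by linarith [ht.2] : 0 ≤ 1 - t)))
    linarith
  have hs : sinh (2 * κ) = sinh (κ * (t + 1)) * cosh (κ * (1 - t))
      + cosh (κ * (t + 1)) * sinh (κ * (1 - t)) := by
    rw [show 2 * κ = κ * (t + 1) + κ * (1 - t) by ring, sinh_add]
  have hQ : 0 ≤ N 1 f + κ ^ 2 * N 0 f :=
    add_nonneg (N_nonneg _ _) (mul_nonneg (sq_nonneg _) (N_nonneg _ _))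
  calc κ * sinh (2 * κ) * D 0 f t ^ 2
      = (cosh (κ * (t + 1)) * cosh (κ * (1 - t))) *
        (κ * (sinh (κ * (t + 1)) / cosh (κ * (t + 1))) * D 0 f t ^ 2
        + κ * (sinh (κ * (1 - t)) / cosh (κ * (1 - t))) * D 0 f t ^ 2) := by
        rw [hs]; field_simp
    _ ≤ (cosh (κ * (t + 1)) * cosh (κ * (1 - t))) * (N 1 f + κ ^ 2 * N 0 f) := by
        refine mul_le_mul_of_nonneg_left ?_ (mul_pos hc1 hc2).le
        rw [neg_div] at h2
        linarith
    _ ≤ _ := mul_le_mul_of_nonneg_right hle hQ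

/-! ### Extremal functions of the functionals at the endpoint -/

lemma D_one_of_hasDerivAt {f f₁ : ℝ → ℝ} (h : ∀ x, HasDerivAt f (f₁ x) x) {x : ℝ} (hx : x ∈ I) :
    D 1 f x = f₁ x := by
  rw [D_succ_congr (j := 0) (g := f) (fun y _ => by rw [D_zero]) hx]
  exact (h x).hasDerivWithinAt.derivWithin (uniqueDiffOn_I x hx)

lemma D_two_of_hasDerivAt {f f₁ f₂ : ℝ → ℝ} (h : ∀ x, HasDerivAt f (f₁ x) x)
    (h₁ : ∀ x, HasDerivAt f₁ (f₂ x) x) {x : ℝ} (hx : x ∈ I) : D 2 f x = f₂ x := by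
  rw [D_succ_congr (j := 1) (g := f₁) (fun y hy => D_one_of_hasDerivAt h hy) hx]
  exact (h₁ x).hasDerivWithinAt.derivWithin (uniqueDiffOn_I x hx)

lemma memLp_of_eqOn_continuous {f g : ℝ → ℝ} (hg : Continuous g) (h : ∀ x ∈ I, f x = g x) :
    MemLp f 2 μI := by
  obtain ⟨C, hC⟩ := (isCompact_Icc (a := (-1 : ℝ)) (b := 1)).exists_bound_of_continuousOn
    hg.continuousOn
  refine (memLp_congr_ae ?_).2 (MemLp.of_bound hg.aestronglyMeasurable.restrict C ?_)
  · filter_upwards [ae_restrict_mem measurableSet_Icc] with x hx using h x hx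
  · filter_upwards [ae_restrict_mem measurableSet_Icc] with x hx using hC x hx

lemma memL2r_one_of_hasDerivAt {f f₁ : ℝ → ℝ} (h : ∀ x, HasDerivAt f (f₁ x) x)
    (hc : Continuous f₁) : MemL2r 1 f where
  contDiffOn := by
    have : Continuous f := continuous_iff_continuousAt.2 fun x => (h x).continuousAt
    simpa using this.continuousOn
  absolutelyContinuous := by
    change AbsolutelyContinuousOnInterval (D 0 f) (-1) 1
    rw [D_zero]
    exact absolutelyContinuous_of_hasDerivAt h hc (-1) 1
  memLp := memLp_of_eqOn_continuous hc fun x hx => D_one_of_hasDerivAt h hx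

lemma memL2r_two_of_hasDerivAt {f f₁ f₂ : ℝ → ℝ} (h : ∀ x, HasDerivAt f (f₁ x) x)
    (h₁ : ∀ x, HasDerivAt f₁ (f₂ x) x) (hc : Continuous f₂) : MemL2r 2 f where
  contDiffOn := by
    have hf₁ : Continuous f₁ := continuous_iff_continuousAt.2 fun x => (h₁ x).continuousAt
    apply ContDiff.contDiffOn
    norm_num
    rw [contDiff_one_iff_deriv, show deriv f = f₁ from funext fun x => (h x).deriv]
    exact ⟨fun x => (h x).differentiableAt, hf₁⟩
  absolutelyContinuous :=
    absolutelyContinuous_congr (fun x hx => (D_one_of_hasDerivAt h hx).symm)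
      (absolutelyContinuous_of_hasDerivAt h₁ hc (-1) 1)
  memLp := memLp_of_eqOn_continuous hc fun x hx => D_two_of_hasDerivAt h h₁ hx

/-- The solutions of `u⁗ = -4u` with `u'' = u''' = 0` at `0`. -/
def freeSol (α β y : ℝ) : ℝ := α * (cosh y * cos y) + β * (cosh y * sin y + sinh y * cos y)

/-- The first derivative of `freeSol`. -/
def freeSol₁ (α β y : ℝ) : ℝ := α * (sinh y * cos y - cosh y * sin y) + 2 * β * (cosh y * cos y)

/-- The second derivative of `freeSol`. -/
def freeSol₂ (α β y : ℝ) : ℝ :=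
  -2 * α * (sinh y * sin y) + 2 * β * (sinh y * cos y - cosh y * sin y)

/-- The third derivative of `freeSol`. -/
def freeSol₃ (α β y : ℝ) : ℝ :=
  -2 * α * (cosh y * sin y + sinh y * cos y) - 4 * β * (sinh y * sin y)

lemma hasDerivAt_freeSol (α β y : ℝ) : HasDerivAt (freeSol α β) (freeSol₁ α β y) y := by
  have hch := hasDerivAt_cosh y
  have hsh := hasDerivAt_sinh y
  have hc := hasDerivAt_cos y
  have hs := hasDerivAt_sin y
  refine (((hch.mul hc).const_mul α).add (((hch.mul hs).add (hsh.mul hc)).const_mul β)).congr_deriv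
    ?_
  unfold freeSol₁; ring

lemma hasDerivAt_freeSol₁ (α β y : ℝ) : HasDerivAt (freeSol₁ α β) (freeSol₂ α β y) y := by
  have hch := hasDerivAt_cosh y
  have hsh := hasDerivAt_sinh y
  have hc := hasDerivAt_cos y
  have hs := hasDerivAt_sin y
  refine ((((hsh.mul hc).sub (hch.mul hs)).const_mul α).add
    ((hch.mul hc).const_mul (2 * β))).congr_deriv ?_
  unfold freeSol₂; ring

lemma hasDerivAt_freeSol₂ (α β y : ℝ) : HasDerivAt (freeSol₂ α β) (freeSol₃ α β y) y := by
  have hch := hasDerivAt_cosh y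
  have hsh := hasDerivAt_sinh y
  have hc := hasDerivAt_cos y
  have hs := hasDerivAt_sin y
  refine (((hsh.mul hs).const_mul (-2 * α)).add
    (((hsh.mul hc).sub (hch.mul hs)).const_mul (2 * β))).congr_deriv ?_
  unfold freeSol₃; ring

lemma hasDerivAt_freeSol₃ (α β y : ℝ) : HasDerivAt (freeSol₃ α β) (-4 * freeSol α β y) y := by
  have hch := hasDerivAt_cosh y
  have hsh := hasDerivAt_sinh y
  have hc := hasDerivAt_cos y
  have hs := hasDerivAt_sin y
  refine ((((hch.mul hs).add (hsh.mul hc)).const_mul (-2 * α)).sub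
    ((hsh.mul hs).const_mul (4 * β))).congr_deriv ?_
  unfold freeSol; ring

lemma hasDerivAt_reflect (κ x : ℝ) : HasDerivAt (fun x => κ * (1 - x)) (-κ) x := by
  simpa using ((hasDerivAt_id x).const_sub 1).const_mul κ

/-- The function is `u(x) = freeSol α β (κ(1 - x))`, which solves `u⁗ = -4κ⁴u` with natural boundary
conditions at `1`. Its energy density has the primitive `u''u' - u'''u`, which vanishes at `1`, so
only the terms at `-1` remain. -/
lemma exists_free_extremal (κ α β : ℝ) : ∃ u, MemL2r 2 u ∧ D 0 u (-1) = freeSol α β (2 * κ) ∧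
    D 1 u (-1) = -κ * freeSol₁ α β (2 * κ) ∧
    N 2 u + 4 * κ ^ 4 * N 0 u = κ ^ 3 * (freeSol₂ α β (2 * κ) * freeSol₁ α β (2 * κ)
      - freeSol₃ α β (2 * κ) * freeSol α β (2 * κ)) := by
  have d0 : ∀ x, HasDerivAt (fun x => freeSol α β (κ * (1 - x)))
      (-κ * freeSol₁ α β (κ * (1 - x))) x := fun x =>
    ((hasDerivAt_freeSol α β _).comp x (hasDerivAt_reflect κ x)).congr_deriv (by ring)
  have d1 : ∀ x, HasDerivAt (fun x => -κ * freeSol₁ α β (κ * (1 - x)))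
      (κ ^ 2 * freeSol₂ α β (κ * (1 - x))) x := fun x =>
    (((hasDerivAt_freeSol₁ α β _).comp x (hasDerivAt_reflect κ x)).const_mul (-κ)).congr_deriv
      (by ring)
  have d2 : ∀ x, HasDerivAt (fun x => κ ^ 2 * freeSol₂ α β (κ * (1 - x)))
      (-κ ^ 3 * freeSol₃ α β (κ * (1 - x))) x := fun x =>
    (((hasDerivAt_freeSol₂ α β _).comp x (hasDerivAt_reflect κ x)).const_mul (κ ^ 2)).congr_deriv
      (by ring)
  have d3 : ∀ x, HasDerivAt (fun x => -κ ^ 3 * freeSol₃ α β (κ * (1 - x)))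
      (-4 * κ ^ 4 * freeSol α β (κ * (1 - x))) x := fun x =>
    (((hasDerivAt_freeSol₃ α β _).comp x (hasDerivAt_reflect κ x)).const_mul (-κ ^ 3)).congr_deriv
      (by ring)
  have c0 : Continuous fun x => freeSol α β (κ * (1 - x)) :=
    continuous_iff_continuousAt.2 fun x => (d0 x).continuousAt
  have c2 : Continuous fun x => κ ^ 2 * freeSol₂ α β (κ * (1 - x)) :=
    continuous_iff_continuousAt.2 fun x => (d2 x).continuousAt
  have hu := memL2r_two_of_hasDerivAt d0 d1 c2
  refine ⟨_, hu, ?_, ?_, ?_⟩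
  · rw [D_zero]; norm_num [mul_comm]
  · rw [D_one_of_hasDerivAt d0 (by simp)]; norm_num [mul_comm]
  · rw [← hu.integral_energy (4 * κ ^ 4)]
    have hI : ∀ x ∈ Set.uIcc (-1 : ℝ) 1,
        HasDerivAt (fun x => κ ^ 2 * freeSol₂ α β (κ * (1 - x)) * (-κ * freeSol₁ α β (κ * (1 - x)))
          - -κ ^ 3 * freeSol₃ α β (κ * (1 - x)) * freeSol α β (κ * (1 - x)))
        ((κ ^ 2 * freeSol₂ α β (κ * (1 - x))) ^ 2
          + 4 * κ ^ 4 * freeSol α β (κ * (1 - x)) ^ 2) x := fun x _ =>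
      (((d2 x).mul (d1 x)).sub ((d3 x).mul (d0 x))).congr_deriv (by ring)
    rw [intervalIntegral.integral_congr (g := fun x => (κ ^ 2 * freeSol₂ α β (κ * (1 - x))) ^ 2
          + 4 * κ ^ 4 * freeSol α β (κ * (1 - x)) ^ 2),
      intervalIntegral.integral_eq_sub_of_hasDerivAt hI
        (Continuous.intervalIntegrable (by fun_prop) _ _)]
    · have e2 : freeSol₂ α β 0 = 0 := by simp [freeSol₂]
      have e3 : freeSol₃ α β 0 = 0 := by simp [freeSol₃]
      rw [show κ * (1 - 1) = 0 by ring, show κ * (1 - -1) = 2 * κ by ring, e2, e3]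
      ring
    · intro x hx
      rw [uIcc_eq_I] at hx
      simp only [D_two_of_hasDerivAt d0 d1 hx, D_zero]

/-- The energy bound at the endpoint `-1` with weights `A` and `B`. -/
def EndpointBound (r k : ℕ) (A B : ℝ) : Prop :=
  ∀ f, MemL2r r f → D k f (-1) ^ 2 ≤ A * N 0 f + B * N r f

/-- Every energy bound for `f^{(k)}(-1)` holds for `f^{(k)}(t)`, `t ∈ 𝕀`. -/
def EndpointDominates (r k : ℕ) : Prop :=
  ∀ A B : ℝ, 0 < A → 0 < B → EndpointBound r k A B →
    ∀ f, MemL2r r f → ∀ t ∈ I, D k f t ^ 2 ≤ A * N 0 f + B * N r f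

/-- The value `f^{(k)}(-1)` is bounded by the energy with an arbitrarily small weight of
`f^{(r)}`. -/
def EndpointSmall (r k : ℕ) : Prop :=
  ∀ B : ℝ, 0 < B → ∃ A : ℝ, 0 < A ∧ EndpointBound r k A B

/-! ### Domination of interior points by the endpoint. -/

lemma exists_weight_ratio {A B : ℝ} (hA : 0 < A) (hB : 0 < B) :
    ∃ κ : ℝ, 0 < κ ∧ A = 4 * κ ^ 4 * B := by
  refine ⟨√√(A / (4 * B)), by positivity, ?_⟩
  rw [show √√(A / (4 * B)) ^ 4 = (√√(A / (4 * B)) ^ 2) ^ 2 by ring, sq_sqrt (sqrt_nonneg _),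
    sq_sqrt (by positivity)]
  field_simp

lemma half_angle (κ : ℝ) : sinh (4 * κ) = 2 * sinh (2 * κ) * cosh (2 * κ) ∧
    sin (4 * κ) = 2 * sin (2 * κ) * cos (2 * κ) ∧
    cosh (4 * κ) + cos (4 * κ) - 2 = 2 * (sinh (2 * κ) ^ 2 - sin (2 * κ) ^ 2) := by
  have e : 4 * κ = 2 * (2 * κ) := by ring
  rw [e, sinh_two_mul, sin_two_mul, cosh_two_mul (2 * κ), cos_two_mul (2 * κ)]
  refine ⟨rfl, rfl, ?_⟩
  linarith [cosh_sq (2 * κ), sin_sq_add_cos_sq (2 * κ)]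

lemma endpointDominates_slope : EndpointDominates 2 1 := by
  intro A B hA hB h f hf t ht
  obtain ⟨κ, hκ, rfl⟩ := exists_weight_ratio hA hB
  obtain ⟨u, hu, -, hu1, huQ⟩ := exists_free_extremal κ (2 * (sinh (2 * κ) * sin (2 * κ)))
    (-(cosh (2 * κ) * sin (2 * κ) + sinh (2 * κ) * cos (2 * κ)))
  have hub := h u hu
  obtain ⟨e1, e2, e3⟩ := half_angle κ
  have hS := sinh_add_sin_pos (x := 4 * κ) (by linarith)
  have hE := cosh_add_cos_gt_two (x := 4 * κ) (by linarith)
  have h1 : freeSol₁ (2 * (sinh (2 * κ) * sin (2 * κ)))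
      (-(cosh (2 * κ) * sin (2 * κ) + sinh (2 * κ) * cos (2 * κ))) (2 * κ)
      = -(sinh (4 * κ) + sin (4 * κ)) := by
    rw [e1, e2]
    unfold freeSol₁
    linear_combination (-2 * sin (2 * κ) * cos (2 * κ)) * cosh_sq (2 * κ)
      - 2 * sinh (2 * κ) * cosh (2 * κ) * sin_sq_add_cos_sq (2 * κ)
  have h2 : freeSol₂ (2 * (sinh (2 * κ) * sin (2 * κ)))
      (-(cosh (2 * κ) * sin (2 * κ) + sinh (2 * κ) * cos (2 * κ))) (2 * κ)
      = -(cosh (4 * κ) + cos (4 * κ) - 2) := by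
    rw [e3]
    unfold freeSol₂
    linear_combination (2 * sin (2 * κ) ^ 2) * cosh_sq (2 * κ)
      - 2 * sinh (2 * κ) ^ 2 * sin_sq_add_cos_sq (2 * κ)
  have h3 : freeSol₃ (2 * (sinh (2 * κ) * sin (2 * κ)))
      (-(cosh (2 * κ) * sin (2 * κ) + sinh (2 * κ) * cos (2 * κ))) (2 * κ) = 0 := by
    unfold freeSol₃; ring
  rw [h1, h2, h3] at huQ
  rw [h1] at hu1
  have hen := slope_sq_le_energy hf hκ ht
  generalize cosh (4 * κ) + cos (4 * κ) = E at *
  generalize sinh (4 * κ) + sin (4 * κ) = S at *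
  have hQ : 0 ≤ N 2 f + 4 * κ ^ 4 * N 0 f :=
    add_nonneg (N_nonneg _ _) (mul_nonneg (by positivity) (N_nonneg _ _))
  have hub' : S ≤ B * κ * (E - 2) := by
    have : κ ^ 2 * S * S ≤ κ ^ 2 * S * (B * κ * (E - 2)) := by
      rw [hu1] at hub
      linear_combination hub + B * huQ
    exact le_of_mul_le_mul_left this (by positivity)
  have hpos : 0 < κ * (E - 2) := mul_pos hκ (by linarith)
  refine le_of_mul_le_mul_left ?_ hpos
  calc κ * (E - 2) * D 1 f t ^ 2 ≤ _ := hen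
    _ ≤ B * κ * (E - 2) * (N 2 f + 4 * κ ^ 4 * N 0 f) := mul_le_mul_of_nonneg_right hub' hQ
    _ = _ := by ring

lemma endpointDominates_value : EndpointDominates 2 0 := by
  intro A B hA hB h f hf t ht
  obtain ⟨κ, hκ, rfl⟩ := exists_weight_ratio hA hB
  obtain ⟨u, hu, hu1, -, huQ⟩ := exists_free_extremal κ
    (sinh (2 * κ) * cos (2 * κ) - cosh (2 * κ) * sin (2 * κ)) (sinh (2 * κ) * sin (2 * κ))
  have hub := h u hu
  obtain ⟨e1, e2, e3⟩ := half_angle κ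
  have hS := sinh_sub_sin_pos (x := 4 * κ) (by linarith)
  have hE := cosh_add_cos_gt_two (x := 4 * κ) (by linarith)
  have h1 : 2 * freeSol (sinh (2 * κ) * cos (2 * κ) - cosh (2 * κ) * sin (2 * κ))
      (sinh (2 * κ) * sin (2 * κ)) (2 * κ) = sinh (4 * κ) - sin (4 * κ) := by
    rw [e1, e2]
    unfold freeSol
    linear_combination (-2 * sin (2 * κ) * cos (2 * κ)) * cosh_sq (2 * κ)
      + 2 * sinh (2 * κ) * cosh (2 * κ) * sin_sq_add_cos_sq (2 * κ)
  have h2 : freeSol₂ (sinh (2 * κ) * cos (2 * κ) - cosh (2 * κ) * sin (2 * κ))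
      (sinh (2 * κ) * sin (2 * κ)) (2 * κ) = 0 := by
    unfold freeSol₂; ring
  have h3 : freeSol₃ (sinh (2 * κ) * cos (2 * κ) - cosh (2 * κ) * sin (2 * κ))
      (sinh (2 * κ) * sin (2 * κ)) (2 * κ) = -(cosh (4 * κ) + cos (4 * κ) - 2) := by
    rw [e3]
    unfold freeSol₃
    linear_combination (2 * sin (2 * κ) ^ 2) * cosh_sq (2 * κ)
      - 2 * sinh (2 * κ) ^ 2 * sin_sq_add_cos_sq (2 * κ)
  rw [h2, h3] at huQ
  rw [← hu1] at huQ h1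
  have hen := value_sq_le_energy hf hκ ht
  generalize cosh (4 * κ) + cos (4 * κ) = E at *
  generalize sinh (4 * κ) - sin (4 * κ) = S at *
  have hQ : 0 ≤ N 2 f + 4 * κ ^ 4 * N 0 f :=
    add_nonneg (N_nonneg _ _) (mul_nonneg (by positivity) (N_nonneg _ _))
  have hub' : S ≤ 2 * B * κ ^ 3 * (E - 2) := by
    have : S * S ≤ S * (2 * B * κ ^ 3 * (E - 2)) := by
      rw [← h1]
      linear_combination 4 * hub + 4 * B * huQ
    exact le_of_mul_le_mul_left this (by positivity)
  have hpos : 0 < 2 * κ ^ 3 * (E - 2) := mul_pos (by positivity) (by linarith)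
  refine le_of_mul_le_mul_left ?_ hpos
  calc 2 * κ ^ 3 * (E - 2) * D 0 f t ^ 2 ≤ _ := hen
    _ ≤ 2 * B * κ ^ 3 * (E - 2) * (N 2 f + 4 * κ ^ 4 * N 0 f) :=
      mul_le_mul_of_nonneg_right hub' hQ
    _ = _ := by ring

lemma endpointDominates_value_one : EndpointDominates 1 0 := by
  intro A B hA hB h f hf t ht
  obtain ⟨κ, hκ, rfl⟩ : ∃ κ : ℝ, 0 < κ ∧ A = κ ^ 2 * B :=
    ⟨√(A / B), by positivity, by rw [sq_sqrt (by positivity)]; field_simp⟩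
  have d0 : ∀ x, HasDerivAt (fun x => cosh (κ * (1 - x))) (-κ * sinh (κ * (1 - x))) x := fun x =>
    (hasDerivAt_reflect κ x).cosh.congr_deriv (by ring)
  have d1 : ∀ x, HasDerivAt (fun x => -κ * sinh (κ * (1 - x))) (κ ^ 2 * cosh (κ * (1 - x))) x :=
    fun x => ((hasDerivAt_reflect κ x).sinh.const_mul (-κ)).congr_deriv (by ring)
  have hu := memL2r_one_of_hasDerivAt d0
    (continuous_iff_continuousAt.2 fun x => (d1 x).continuousAt)
  have hub := h _ hu
  have huQ := hu.integral_energy (κ ^ 2)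
  have hI : ∀ x ∈ Set.uIcc (-1 : ℝ) 1,
      HasDerivAt (fun x => -κ * sinh (κ * (1 - x)) * cosh (κ * (1 - x)))
      ((-κ * sinh (κ * (1 - x))) ^ 2 + κ ^ 2 * cosh (κ * (1 - x)) ^ 2) x := fun x _ =>
    ((d1 x).mul (d0 x)).congr_deriv (by ring)
  rw [intervalIntegral.integral_congr (g := fun x => (-κ * sinh (κ * (1 - x))) ^ 2
        + κ ^ 2 * cosh (κ * (1 - x)) ^ 2),
    intervalIntegral.integral_eq_sub_of_hasDerivAt hI
      (Continuous.intervalIntegrable (by fun_prop) _ _)] at huQ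
  swap
  · intro x hx
    rw [uIcc_eq_I] at hx
    simp only [D_one_of_hasDerivAt d0 hx, D_zero]
  rw [show D 0 (fun x => cosh (κ * (1 - x))) (-1) = cosh (2 * κ) by
    rw [D_zero]; norm_num [mul_comm]] at hub
  simp only [sub_self, mul_zero, sinh_zero, zero_mul, zero_sub,
    show κ * (1 - -1) = 2 * κ by ring] at huQ
  have hen := value_sq_le_energy_one hf hκ ht
  have hc := cosh_pos (2 * κ)
  have hs := sinh_pos_iff.2 (show 0 < 2 * κ by positivity)
  have hQ : 0 ≤ N 1 f + κ ^ 2 * N 0 f :=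
    add_nonneg (N_nonneg _ _) (mul_nonneg (by positivity) (N_nonneg _ _))
  have hub' : cosh (2 * κ) ≤ B * κ * sinh (2 * κ) := by
    refine le_of_mul_le_mul_left (a := cosh (2 * κ)) ?_ hc
    linear_combination hub - B * huQ
  refine le_of_mul_le_mul_left ?_ (mul_pos hκ hs)
  calc κ * sinh (2 * κ) * D 0 f t ^ 2 ≤ _ := hen
    _ ≤ B * κ * sinh (2 * κ) * (N 1 f + κ ^ 2 * N 0 f) := mul_le_mul_of_nonneg_right hub' hQ
    _ = _ := by ring

lemma endpointSmall_slope : EndpointSmall 2 1 := by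
  intro B hB
  set κ : ℝ := max 1 (2 / B) with hκ
  have h1 : 1 ≤ κ := le_max_left _ _
  have h2 : 2 ≤ κ * B := (div_le_iff₀ hB).1 (le_max_right _ _)
  refine ⟨4 * κ ^ 4 * B, by positivity, fun f hf => ?_⟩
  have hen := slope_sq_le_energy hf (κ := κ) (by linarith) (t := -1) (by simp)
  have hE := sinh_le_two_mul_cosh_add_cos (z := 4 * κ) (by linarith)
  have hE' := cosh_add_cos_gt_two (x := 4 * κ) (by linarith)
  have hs := sin_le_one (4 * κ)
  have hQ : 0 ≤ N 2 f + 4 * κ ^ 4 * N 0 f :=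
    add_nonneg (N_nonneg _ _) (mul_nonneg (by positivity) (N_nonneg _ _))
  generalize cosh (4 * κ) + cos (4 * κ) = E at *
  refine le_of_mul_le_mul_left ?_ (mul_pos (by linarith : 0 < κ) (by linarith : 0 < E - 2))
  calc κ * (E - 2) * D 1 f (-1) ^ 2 ≤ _ := hen
    _ ≤ (κ * B * (E - 2)) * (N 2 f + 4 * κ ^ 4 * N 0 f) := by
      refine mul_le_mul_of_nonneg_right ?_ hQ
      have := mul_le_mul_of_nonneg_right h2 (by linarith : 0 ≤ E - 2)
      linarith
    _ = _ := by ring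

lemma endpointSmall_value : EndpointSmall 2 0 := by
  intro B hB
  set κ : ℝ := max 1 (2 / B) with hκ
  have h1 : 1 ≤ κ := le_max_left _ _
  have h2 : 2 ≤ κ * B := (div_le_iff₀ hB).1 (le_max_right _ _)
  refine ⟨4 * κ ^ 4 * B, by positivity, fun f hf => ?_⟩
  have hen := value_sq_le_energy hf (κ := κ) (by linarith) (t := -1) (by simp)
  have hE := sinh_le_two_mul_cosh_add_cos (z := 4 * κ) (by linarith)
  have hE' := cosh_add_cos_gt_two (x := 4 * κ) (by linarith)
  have hs := neg_one_le_sin (4 * κ)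
  have hQ : 0 ≤ N 2 f + 4 * κ ^ 4 * N 0 f :=
    add_nonneg (N_nonneg _ _) (mul_nonneg (by positivity) (N_nonneg _ _))
  generalize cosh (4 * κ) + cos (4 * κ) = E at *
  have h3 : κ * B ≤ κ ^ 3 * B := by
    have : κ ^ 1 ≤ κ ^ 3 := pow_le_pow_right₀ h1 (by norm_num)
    rw [pow_one] at this
    exact mul_le_mul_of_nonneg_right this hB.le
  refine le_of_mul_le_mul_left ?_ (mul_pos (by positivity : 0 < 2 * κ ^ 3)
    (by linarith : 0 < E - 2))
  calc 2 * κ ^ 3 * (E - 2) * D 0 f (-1) ^ 2 ≤ _ := hen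
    _ ≤ (2 * κ ^ 3 * B * (E - 2)) * (N 2 f + 4 * κ ^ 4 * N 0 f) := by
      refine mul_le_mul_of_nonneg_right ?_ hQ
      have := mul_le_mul_of_nonneg_right (h2.trans h3) (by linarith : 0 ≤ E - 2)
      linarith
    _ = _ := by ring

lemma endpointSmall_value_one : EndpointSmall 1 0 := by
  intro B hB
  set κ : ℝ := max 1 (2 / B) with hκ
  have h1 : 1 ≤ κ := le_max_left _ _
  have h2 : 2 ≤ κ * B := (div_le_iff₀ hB).1 (le_max_right _ _)
  refine ⟨κ ^ 2 * B, by positivity, fun f hf => ?_⟩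
  have hen := value_sq_le_energy_one hf (κ := κ) (by linarith) (t := -1) (by simp)
  have hs : 1 ≤ sinh (2 * κ) := by
    have := self_le_sinh_iff.2 (show 0 ≤ 2 * κ by linarith)
    linarith
  have hc : cosh (2 * κ) ≤ 2 * sinh (2 * κ) := by
    have := cosh_sq (2 * κ)
    nlinarith
  have hQ : 0 ≤ N 1 f + κ ^ 2 * N 0 f :=
    add_nonneg (N_nonneg _ _) (mul_nonneg (by positivity) (N_nonneg _ _))
  refine le_of_mul_le_mul_left ?_ (mul_pos (by linarith : 0 < κ) (by linarith : 0 < sinh (2 * κ)))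
  calc κ * sinh (2 * κ) * D 0 f (-1) ^ 2 ≤ _ := hen
    _ ≤ (κ * B * sinh (2 * κ)) * (N 1 f + κ ^ 2 * N 0 f) := by
      refine mul_le_mul_of_nonneg_right ?_ hQ
      have := mul_le_mul_of_nonneg_right h2 (by linarith : 0 ≤ sinh (2 * κ))
      linarith
    _ = _ := by ring

/-! ### Duality for the functional at the endpoint -/

lemma exists_weights_of_convex {C : Set (ℝ × ℝ)} (hC : Convex ℝ C) (hne : C.Nonempty)
    {x y : ℝ} (hx : 0 < x) (hy : 0 < y) (hdisj : ∀ p ∈ C, x ≤ p.1 ∨ y ≤ p.2) :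
    ∃ a b : ℝ, 0 ≤ a ∧ 0 ≤ b ∧ a * x + b * y = 1 ∧ ∀ p ∈ C, 1 ≤ a * p.1 + b * p.2 := by
  obtain ⟨φ, u, h1, h2⟩ := geometric_hahn_banach_open (s := Set.Iio x ×ˢ Set.Iio y) (t := C)
    ((convex_Iio x).prod (convex_Iio y)) (isOpen_Iio.prod isOpen_Iio) hC (by
      rw [Set.disjoint_left]
      rintro p ⟨hp1, hp2⟩ hpC
      rcases hdisj p hpC with h | h
      · exact absurd hp1 (not_lt.2 h)
      · exact absurd hp2 (not_lt.2 h))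
  set α := φ (1, 0) with hα
  set β := φ (0, 1) with hβ
  have hφ : ∀ s t : ℝ, φ (s, t) = α * s + β * t := by
    intro s t
    have : ((s, t) : ℝ × ℝ) = s • (1, 0) + t • (0, 1) := by simp
    rw [this, map_add, map_smul, map_smul, smul_eq_mul, smul_eq_mul, mul_comm, mul_comm t]
  have h1' : ∀ s t : ℝ, s < x → t < y → α * s + β * t < u := fun s t hs ht => by
    rw [← hφ]; exact h1 _ ⟨hs, ht⟩
  have hle : α * x + β * y ≤ u := by
    have hc : Continuous fun τ : ℝ => α * (x - τ) + β * (y - τ) := by fun_prop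
    have ht : Filter.Tendsto (fun τ : ℝ => α * (x - τ) + β * (y - τ)) (nhdsWithin 0 (Set.Ioi 0))
        (nhds (α * x + β * y)) := by
      simpa using (hc.tendsto 0).mono_left nhdsWithin_le_nhds
    refine le_of_tendsto ht ?_
    filter_upwards [self_mem_nhdsWithin] with τ hτ
    have hτ' : 0 < τ := hτ
    exact (h1' _ _ (by linarith) (by linarith)).le
  have hα0 : 0 ≤ α := by
    by_contra! hneg
    have h := h1' (x - 1 - |u - (α * x + β * (y - 1))| / (-α)) (y - 1)
      (by have : 0 ≤ |u - (α * x + β * (y - 1))| / (-α) := div_nonneg (abs_nonneg _) (by linarith)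
          linarith) (by linarith)
    have e : α * (x - 1 - |u - (α * x + β * (y - 1))| / (-α)) =
        α * (x - 1) + |u - (α * x + β * (y - 1))| := by
      have : α ≠ 0 := hneg.ne
      field_simp
      ring
    have := le_abs_self (u - (α * x + β * (y - 1)))
    rw [e] at h
    linarith
  have hβ0 : 0 ≤ β := by
    by_contra! hneg
    have h := h1' (x - 1) (y - 1 - |u - (α * (x - 1) + β * y)| / (-β)) (by linarith)
      (by have : 0 ≤ |u - (α * (x - 1) + β * y)| / (-β) := div_nonneg (abs_nonneg _) (by linarith)
          linarith)
    have e : β * (y - 1 - |u - (α * (x - 1) + β * y)| / (-β)) =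
        β * (y - 1) + |u - (α * (x - 1) + β * y)| := by
      have : β ≠ 0 := hneg.ne
      field_simp
      ring
    have := le_abs_self (u - (α * (x - 1) + β * y))
    rw [e] at h
    linarith
  have hs : 0 < α * x + β * y := by
    rcases hα0.lt_or_eq with h | h
    · have := mul_pos h hx
      have := mul_nonneg hβ0 hy.le
      linarith
    rcases hβ0.lt_or_eq with h' | h'
    · have := mul_pos h' hy
      have := mul_nonneg hα0 hx.le
      linarith
    obtain ⟨p, hp⟩ := hne
    have h3 := h2 p hp
    have h4 := h1' (x - 1) (y - 1) (by linarith) (by linarith)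
    rw [← Prod.mk.eta (p := p), hφ] at h3
    rw [← h, ← h'] at h3 h4
    linarith
  refine ⟨α / (α * x + β * y), β / (α * x + β * y), by positivity, by positivity, by field_simp,
    fun p hp => ?_⟩
  have h3 := h2 p hp
  rw [← Prod.mk.eta (p := p), hφ] at h3
  rw [div_mul_eq_mul_div, div_mul_eq_mul_div, ← add_div, le_div_iff₀ hs]
  linarith

lemma D_add_ae_of_le {r j : ℕ} {f g : ℝ → ℝ} (hf : MemL2r r f) (hg : MemL2r r g) (hj : j ≤ r) :
    D j (f + g) =ᵐ[μI] D j f + D j g := by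
  rcases Nat.eq_zero_or_pos j with rfl | h
  · simp
  · obtain ⟨i, rfl⟩ := Nat.exists_eq_succ_of_ne_zero h.ne'
    exact D_add_ae hf hg (by omega)

lemma D_smul_ae_of_le {r j : ℕ} {f : ℝ → ℝ} (c : ℝ) (hf : MemL2r r f) (hj : j ≤ r) :
    D j (c • f) =ᵐ[μI] c • D j f := by
  rcases Nat.eq_zero_or_pos j with rfl | h
  · simp
  · obtain ⟨i, rfl⟩ := Nat.exists_eq_succ_of_ne_zero h.ne'
    exact D_smul_ae c hf (by omega)

lemma N_smul {r j : ℕ} {f : ℝ → ℝ} (c : ℝ) (hf : MemL2r r f) (hj : j ≤ r) :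
    N j (c • f) = c ^ 2 * N j f := by
  rw [N_eq, N_eq, ← integral_const_mul]
  apply integral_congr_ae
  filter_upwards [D_smul_ae_of_le c hf hj] with x hx
  rw [hx]; simp; ring

lemma N_convex {r j : ℕ} (hr : 0 < r) {f g : ℝ → ℝ} (hf : MemL2r r f) (hg : MemL2r r g)
    (hj : j ≤ r) {a b : ℝ} (ha : 0 ≤ a) (hb : 0 ≤ b) (hab : a + b = 1) :
    N j (a • f + b • g) ≤ a * N j f + b * N j g := by
  rw [N_eq, N_eq, N_eq, ← integral_const_mul, ← integral_const_mul,
    ← integral_add ((hf.memLp_D hj).integrable_sq.const_mul a)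
      ((hg.memLp_D hj).integrable_sq.const_mul b)]
  refine integral_mono_ae (((hf.smul hr a).add hr (hg.smul hr b)).memLp_D hj).integrable_sq
    (((hf.memLp_D hj).integrable_sq.const_mul a).add
      ((hg.memLp_D hj).integrable_sq.const_mul b)) ?_
  filter_upwards [D_add_ae_of_le (hf.smul hr a) (hg.smul hr b) hj, D_smul_ae_of_le a hf hj,
    D_smul_ae_of_le b hg hj] with x h1 h2 h3
  simp only [h1, Pi.add_apply, h2, h3, Pi.smul_apply, smul_eq_mul]
  obtain rfl : b = 1 - a := by linarith
  have := mul_nonneg (mul_nonneg ha hb) (sq_nonneg (D j f x - D j g x))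
  linarith

lemma exists_endpointBound {r k : ℕ} (hk : k < r) {δ M ε : ℝ} (hδ : 0 < δ) (hM : 0 ≤ M)
    (hε : 0 < ε)
    (h : ∀ f, MemL2r r f → N 0 f ≤ δ ^ 2 → N r f ≤ 1 → |D k f (-1)| ≤ M) :
    ∃ A B : ℝ, 0 < A ∧ 0 < B ∧ A * δ ^ 2 + B ≤ M ^ 2 + ε ∧ EndpointBound r k A B := by
  have hr : 0 < r := by omega
  have hm1 : (-1 : ℝ) ∈ I := by simp
  set m : ℝ := M ^ 2 + ε / 2 with hm
  have hmpos : 0 < m := by positivity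
  set C : Set (ℝ × ℝ) := {p | ∃ f, MemL2r r f ∧ D k f (-1) = 1 ∧ N 0 f ≤ p.1 ∧ N r f ≤ p.2}
    with hC
  have hconv : Convex ℝ C := by
    rintro p ⟨f, hf, hf1, hf2, hf3⟩ q ⟨g, hg, hg1, hg2, hg3⟩ a b ha hb hab
    refine ⟨a • f + b • g, (hf.smul hr a).add hr (hg.smul hr b), ?_, ?_, ?_⟩
    · rw [D_add (hf.smul hr a) (hg.smul hr b) hk hm1, D_smul a hf hk hm1, D_smul b hg hk hm1,
        hf1, hg1]
      linarith
    · refine (N_convex hr hf hg (Nat.zero_le _) ha hb hab).trans ?_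
      simp only [Prod.fst_add, Prod.smul_fst, smul_eq_mul]
      gcongr
    · refine (N_convex hr hf hg le_rfl ha hb hab).trans ?_
      simp only [Prod.snd_add, Prod.smul_snd, smul_eq_mul]
      gcongr
  have hdisj : ∀ p ∈ C, δ ^ 2 / m ≤ p.1 ∨ 1 / m ≤ p.2 := by
    rintro p ⟨f, hf, hf1, hf2, hf3⟩
    by_contra! hcon
    have hM' := h (√m • f) (hf.smul hr _) ?_ ?_
    · rw [D_smul _ hf hk hm1, hf1, mul_one, abs_of_nonneg (sqrt_nonneg _), sqrt_le_left hM] at hM'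
      linarith
    · rw [N_smul _ hf (Nat.zero_le _), sq_sqrt hmpos.le]
      have := (lt_div_iff₀ hmpos).1 hcon.1
      nlinarith
    · rw [N_smul _ hf le_rfl, sq_sqrt hmpos.le]
      have := (lt_div_iff₀ hmpos).1 hcon.2
      nlinarith
  have hscale : ∀ a b : ℝ, 0 ≤ a → 0 ≤ b → (∀ p ∈ C, 1 ≤ a * p.1 + b * p.2) →
      ∀ f, MemL2r r f → D k f (-1) ^ 2 ≤ a * N 0 f + b * N r f := by
    intro a b ha hb hab f hf
    by_cases hc : D k f (-1) = 0
    · rw [hc]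
      have := mul_nonneg ha (N_nonneg 0 f)
      have := mul_nonneg hb (N_nonneg r f)
      linarith
    · have := hab (N 0 ((D k f (-1))⁻¹ • f), N r ((D k f (-1))⁻¹ • f))
        ⟨_, hf.smul hr _, by rw [D_smul _ hf hk hm1, inv_mul_cancel₀ hc], le_rfl, le_rfl⟩
      simp only [N_smul _ hf (Nat.zero_le _), N_smul _ hf le_rfl] at this
      have hpos : 0 < D k f (-1) ^ 2 := by positivity
      have h2 := mul_le_mul_of_nonneg_left this hpos.le
      have e : D k f (-1) ^ 2 * (a * ((D k f (-1))⁻¹ ^ 2 * N 0 f)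
          + b * ((D k f (-1))⁻¹ ^ 2 * N r f)) = a * N 0 f + b * N r f := by
        field_simp
      rw [e] at h2
      linarith
  obtain ⟨a, b, ha, hb, hsum, hab⟩ : ∃ a b : ℝ, 0 ≤ a ∧ 0 ≤ b ∧ a * δ ^ 2 + b ≤ m ∧
      ∀ p ∈ C, 1 ≤ a * p.1 + b * p.2 := by
    by_cases hne : C.Nonempty
    · obtain ⟨a, b, ha, hb, hs, hab⟩ := exists_weights_of_convex hconv hne
        (x := δ ^ 2 / m) (y := 1 / m) (by positivity) (by positivity) hdisj
      refine ⟨a, b, ha, hb, ?_, hab⟩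
      field_simp at hs
      exact hs.le
    · refine ⟨0, 0, le_rfl, le_rfl, by simpa using hmpos.le, fun p hp => absurd ⟨p, hp⟩ hne⟩
  set η : ℝ := ε / 2 / (δ ^ 2 + 1) with hη
  have hη0 : 0 < η := by positivity
  refine ⟨a + η, b + η, by positivity, by positivity, ?_, fun f hf => ?_⟩
  · have : η * (δ ^ 2 + 1) = ε / 2 := by rw [hη]; field_simp
    linarith
  · have h1 := hscale a b ha hb hab f hf
    have := mul_nonneg hη0.le (N_nonneg 0 f)
    have := mul_nonneg hη0.le (N_nonneg r f)
    linarith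

/-! ### Recovery by a linear operator -/

lemma exists_contraction_extension {V H Y : Type*} [AddCommGroup V] [Module ℝ V]
    [NormedAddCommGroup H] [InnerProductSpace ℝ H] [CompleteSpace H]
    [NormedAddCommGroup Y] [NormedSpace ℝ Y] [CompleteSpace Y]
    (e : V →ₗ[ℝ] H) (F : V →ₗ[ℝ] Y) (h : ∀ v, ‖F v‖ ≤ ‖e v‖) :
    ∃ G : H →L[ℝ] Y, (∀ v, G (e v) = F v) ∧ ∀ x, ‖G x‖ ≤ ‖x‖ := by
  let K : Submodule ℝ H := (LinearMap.range e).topologicalClosure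
  have : CompleteSpace K := (LinearMap.range e).isClosed_topologicalClosure.completeSpace_coe
  let e' : V →ₗ[ℝ] K := e.codRestrict K fun v =>
    (LinearMap.range e).le_topologicalClosure (LinearMap.mem_range_self e v)
  have hd : DenseRange e' := by
    rintro ⟨x, hx⟩
    rw [closure_subtype, ← Set.range_comp]
    exact hx
  have hn : ∀ v, ‖F v‖ ≤ 1 * ‖e' v‖ := fun v => by rw [one_mul]; exact h v
  refine ⟨(F.extendOfNorm e').comp K.orthogonalProjectionOnto, fun v => ?_, fun x => ?_⟩
  · have : K.orthogonalProjectionOnto (e v) = e' v :=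
      Submodule.orthogonalProjectionOnto_mem_subspace_eq_self (e' v)
    rw [ContinuousLinearMap.comp_apply, this]
    exact LinearMap.extendOfNorm_eq hd ⟨1, hn⟩ v
  · refine (LinearMap.norm_extendOfNorm_apply_le hd 1 hn _).trans ?_
    rw [one_mul]
    exact K.norm_orthogonalProjectionOnto_apply_le x

/-- The space `L_2^r`. -/
def L2r (r : ℕ) (hr : 0 < r) : Submodule ℝ (ℝ → ℝ) where
  carrier := {f | MemL2r r f}
  add_mem' hf hg := hf.add hr hg
  zero_mem' := memL2r_zero
  smul_mem' c _ hf := hf.smul hr c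

/-- The linear map `f ↦ f^{(j)}` to `L_p`. -/
def derivLp (r : ℕ) (hr : 0 < r) (j : ℕ) (hj : j ≤ r) (p : ℝ≥0∞)
    (hp : ∀ f, MemL2r r f → MemLp (D j f) p μI) : L2r r hr →ₗ[ℝ] LI p where
  toFun f := (hp f.1 f.2).toLp (D j f.1)
  map_add' f g := by
    rw [← MemLp.toLp_add]
    exact MemLp.toLp_congr _ _ (D_add_ae_of_le f.2 g.2 hj)
  map_smul' c f := by
    rw [RingHom.id_apply, ← MemLp.toLp_const_smul]
    exact MemLp.toLp_congr _ _ (D_smul_ae_of_le c f.2 hj)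

lemma norm_derivLp_two_sq {r : ℕ} (hr : 0 < r) {j : ℕ} (hj : j ≤ r) (f : L2r r hr) :
    ‖derivLp r hr j hj 2 (fun _ hf => hf.memLp_D hj) f‖ ^ 2 = N j f.1 := by
  change ‖(MemL2r.memLp_D f.2 hj).toLp (D j f.1)‖ ^ 2 = _
  rw [Lp.norm_toLp, eLpNorm_two_eq (MemL2r.memLp_D f.2 hj), ← N_eq,
    ENNReal.toReal_ofReal (sqrt_nonneg _), sq_sqrt (N_nonneg _ _)]

lemma MemL2r.memLp_top {r j : ℕ} {f : ℝ → ℝ} (hf : MemL2r r f) (hj : j < r) :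
    MemLp (D j f) ∞ μI := by
  have hc := hf.continuousOn hj
  obtain ⟨C, hC⟩ := isCompact_Icc.exists_bound_of_continuousOn hc
  refine memLp_top_of_bound (hc.aestronglyMeasurable measurableSet_Icc) C ?_
  filter_upwards [ae_restrict_mem measurableSet_Icc] with x hx using hC x hx

lemma exists_linear_recovery {r k : ℕ} (hk : k < r) {A B : ℝ} (hA : 0 ≤ A) (hB : 0 ≤ B)
    (h : ∀ f, MemL2r r f → ∀ t ∈ I, D k f t ^ 2 ≤ A * N 0 f + B * N r f) :
    ∃ S ∈ linearMaps, ∀ δ : ℝ≥0,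
      recoveryErrorOf r k δ S ≤ ENNReal.ofReal √(A * (δ : ℝ) ^ 2 + B) := by
  have hr : 0 < r := by omega
  let T₀ := derivLp r hr 0 (Nat.zero_le _) 2 (fun _ hf => hf.memLp_D (Nat.zero_le _))
  let Tr := derivLp r hr r le_rfl 2 (fun _ hf => hf.memLp_D le_rfl)
  let F := derivLp r hr k hk.le ∞ (fun _ hf => hf.memLp_top hk)
  let J : (LI 2 × LI 2) →ₗ[ℝ] WithLp 2 (LI 2 × LI 2) :=
    (WithLp.linearEquiv 2 ℝ (LI 2 × LI 2)).symm.toLinearMap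
  let e : L2r r hr →ₗ[ℝ] WithLp 2 (LI 2 × LI 2) := J ∘ₗ (√A • T₀).prod (√B • Tr)
  have hJ : ∀ y z : LI 2, ‖J (√A • y, √B • z)‖ ^ 2 = A * ‖y‖ ^ 2 + B * ‖z‖ ^ 2 := by
    intro y z
    rw [WithLp.prod_norm_sq_eq_of_L2]
    change ‖√A • y‖ ^ 2 + ‖√B • z‖ ^ 2 = _
    rw [norm_smul, norm_smul, mul_pow, mul_pow, norm_eq_abs, norm_eq_abs, sq_abs, sq_abs,
      sq_sqrt hA, sq_sqrt hB]
  have hF : ∀ f, ‖F f‖ ≤ ‖e f‖ := by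
    intro f
    have he : ‖e f‖ ^ 2 = A * N 0 f.1 + B * N r f.1 := by
      change ‖J (√A • T₀ f, √B • Tr f)‖ ^ 2 = _
      rw [hJ, norm_derivLp_two_sq, norm_derivLp_two_sq]
    change ‖(MemL2r.memLp_top f.2 hk).toLp (D k f.1)‖ ≤ _
    rw [Lp.norm_toLp, eLpNorm_exponent_top]
    refine ENNReal.toReal_le_of_le_ofReal (norm_nonneg _) (eLpNormEssSup_le_of_ae_bound ?_)
    filter_upwards [ae_restrict_mem measurableSet_Icc] with x hx
    refine abs_le_of_sq_le_sq (le_of_le_of_eq (h f.1 f.2 x hx) he.symm) (norm_nonneg _)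
  obtain ⟨G, hG1, hG2⟩ := exists_contraction_extension e F hF
  refine ⟨fun y => G (J (√A • y, √B • (0 : LI 2))), ⟨fun y z => ?_, fun c y => ?_⟩, fun δ => ?_⟩
  · rw [← map_add, ← map_add]
    simp
  · rw [← map_smul, ← map_smul]
    congr 2
    simp [smul_comm c]
  · refine iSup₂_le fun f hf => iSup₂_le fun y hy => ?_
    let v : L2r r hr := ⟨f, hf.1⟩
    have hSub : (fun x => D k f x - G (J (√A • y, √B • (0 : LI 2))) x) =ᵐ[μI]
        (G (J (√A • (T₀ v - y), √B • Tr v)) : LI ∞) := by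
      have e1 : J (√A • (T₀ v - y), √B • Tr v) = e v - J (√A • y, √B • (0 : LI 2)) := by
        change _ = J (√A • T₀ v, √B • Tr v) - _
        rw [← map_sub]
        simp [smul_sub]
      rw [e1, map_sub, hG1]
      filter_upwards [Lp.coeFn_sub (F v) (G (J (√A • y, √B • (0 : LI 2)))),
        MemLp.coeFn_toLp (hf.1.memLp_top hk)] with x h1 h2
      rw [h1, Pi.sub_apply]
      exact congrArg (· - _) h2.symm
    rw [eLpNorm_congr_ae hSub, ← Lp.enorm_def, ← ofReal_norm]
    apply ENNReal.ofReal_le_ofReal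
    refine (hG2 _).trans (le_sqrt_of_sq_le ?_)
    rw [hJ, norm_derivLp_two_sq]
    have h1 : N r f ≤ 1 := by
      simpa using (hf.1.eLpNorm_D_le_iff le_rfl 1).1 (by simpa using hf.2)
    have h2 : ‖T₀ v - y‖ ≤ δ := by
      rw [Lp.norm_def]
      refine ENNReal.toReal_le_coe_of_le_coe (le_of_eq_of_le (eLpNorm_congr_ae ?_) hy)
      filter_upwards [Lp.coeFn_sub (T₀ v) y,
        MemLp.coeFn_toLp (hf.1.memLp_D (Nat.zero_le _))] with x h1 h2
      rw [h1, Pi.sub_apply]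
      refine congrArg (· - _) (h2.trans ?_)
      rw [D_zero]
    have h3 : B * N r v.1 ≤ B := by simpa using mul_le_mul_of_nonneg_left h1 hB
    have h4 : ‖T₀ v - y‖ ^ 2 ≤ (δ : ℝ) ^ 2 := by gcongr
    have h5 := mul_le_mul_of_nonneg_left h4 hA
    linarith

/-! ### Comparison of the moduli and the recovery error -/

lemma pointModulus_le_modulus {r k : ℕ} (hk : k < r) {t : ℝ} (ht : t ∈ I) (δ : ℝ≥0) :
    pointModulus r k t δ ≤ modulus r k δ := by
  refine iSup₂_mono fun f hf => iSup_mono fun _ => ?_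
  have hc := hf.1.continuousOn hk
  have htop := (hf.1.memLp_top hk).eLpNorm_ne_top
  set c := (eLpNorm (D k f) ∞ μI).toReal with hcdef
  have hae : (fun x => max |D k f x| c) =ᵐ[volume.restrict I] fun _ => c := by
    have := ae_le_eLpNormEssSup (f := D k f) (μ := μI)
    filter_upwards [this] with x hx
    rw [← eLpNorm_exponent_top] at hx
    refine max_eq_right ?_
    have h2 := ENNReal.toReal_mono htop hx
    rwa [toReal_enorm, norm_eq_abs] at h2
  have := Measure.eqOn_Icc_of_ae_eq volume (by norm_num) hae
    (ContinuousOn.sup hc.abs continuousOn_const) continuousOn_const ht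
  have h3 : |D k f t| ≤ c := max_eq_right_iff.1 this
  exact ENNReal.ofReal_le_of_le_toReal h3

lemma neg_mem_W {r : ℕ} (hr : 0 < r) {f : ℝ → ℝ} (hf : f ∈ W r) : (-1 : ℝ) • f ∈ W r := by
  refine ⟨hf.1.smul hr _, ?_⟩
  rw [eLpNorm_congr_ae (D_smul_ae_of_le (-1) hf.1 le_rfl)]
  simpa [eLpNorm_neg] using hf.2

lemma modulus_le_recoveryErrorOf {r k : ℕ} (hk : k < r) (δ : ℝ≥0) (S : LI 2 → LI ∞) :
    modulus r k δ ≤ recoveryErrorOf r k δ S := by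
  have hr : 0 < r := by omega
  refine iSup₂_le fun f hf => iSup_le fun hδ => ?_
  have h0 : ∀ g : ℝ → ℝ, (fun x => g x - (0 : LI 2) x) =ᵐ[μI] g := fun g => by
    filter_upwards [Lp.coeFn_zero ℝ 2 μI] with x hx
    simp only [hx, Pi.zero_apply, sub_zero]
  have key : ∀ g ∈ W r, eLpNorm g 2 μI ≤ δ →
      eLpNorm (fun x => D k g x - S 0 x) ∞ μI ≤ recoveryErrorOf r k δ S := fun g hg hgδ =>
    le_iSup₂_of_le g hg (le_iSup₂_of_le (0 : LI 2) (by rwa [eLpNorm_congr_ae (h0 g)]) le_rfl)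
  have h1 := key f hf hδ
  have h2 := key _ (neg_mem_W hr hf) (by simpa [eLpNorm_neg] using hδ)
  have m1 : AEStronglyMeasurable (fun x => D k f x - S 0 x) μI :=
    (hf.1.memLp_top hk).1.sub (Lp.aestronglyMeasurable _)
  have m2 : AEStronglyMeasurable (fun x => D k ((-1 : ℝ) • f) x - S 0 x) μI :=
    ((neg_mem_W hr hf).1.memLp_top hk).1.sub (Lp.aestronglyMeasurable _)
  have h3 := (eLpNorm_sub_le m1 m2 le_top).trans (add_le_add h1 h2)
  have h4 : ((fun x => D k f x - S 0 x) - fun x => D k ((-1 : ℝ) • f) x - S 0 x) =ᵐ[μI]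
      (2 : ℝ) • D k f := by
    filter_upwards [D_smul_ae_of_le (-1) hf.1 hk.le] with x hx
    simp only [Pi.sub_apply, hx, Pi.smul_apply, smul_eq_mul]
    ring
  rw [eLpNorm_congr_ae h4, eLpNorm_const_smul, ← two_mul] at h3
  have h5 : ‖(2 : ℝ)‖ₑ = 2 := by
    rw [← ofReal_norm]; norm_num
  rw [h5] at h3
  exact (ENNReal.mul_le_mul_iff_right (by norm_num) (by norm_num)).1 h3

lemma abs_D_le_pointModulus {r k : ℕ} {t : ℝ} {δ : ℝ≥0} {f : ℝ → ℝ}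
    (hfin : pointModulus r k t δ < ∞) (hf : MemL2r r f) (h0 : N 0 f ≤ (δ : ℝ) ^ 2)
    (h1 : N r f ≤ 1) : |D k f t| ≤ (pointModulus r k t δ).toReal := by
  rw [← ENNReal.ofReal_le_iff_le_toReal hfin.ne]
  have hW : f ∈ W r := ⟨hf, by simpa using (hf.eLpNorm_D_le_iff le_rfl 1).2 (by simpa using h1)⟩
  have hδ : eLpNorm f 2 μI ≤ δ := by
    have := (hf.eLpNorm_D_le_iff (Nat.zero_le _) δ).2 h0
    rwa [D_zero] at this
  exact le_iSup₂_of_le f hW (le_iSup_of_le hδ le_rfl)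

lemma pointModulus_lt_top {r k : ℕ} (hsmall : EndpointSmall r k) (δ : ℝ≥0) :
    pointModulus r k (-1) δ < ∞ := by
  obtain ⟨A, hA, hb⟩ := hsmall 1 one_pos
  refine lt_of_le_of_lt (b := ENNReal.ofReal √(A * (δ : ℝ) ^ 2 + 1)) ?_ ENNReal.ofReal_lt_top
  refine iSup₂_le fun f hf => iSup_le fun hδ => ENNReal.ofReal_le_ofReal (abs_le_sqrt ?_)
  have h1 : N r f ≤ 1 := by
    simpa using (hf.1.eLpNorm_D_le_iff le_rfl 1).1 (by simpa using hf.2)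
  have h0 : N 0 f ≤ (δ : ℝ) ^ 2 :=
    (hf.1.eLpNorm_D_le_iff (Nat.zero_le _) δ).1 (by rwa [D_zero])
  have := mul_le_mul_of_nonneg_left h0 hA.le
  linarith [hb f hf.1]

lemma recoveryError_linear_le_pointModulus {r k : ℕ} (hk : k < r) (hsmall : EndpointSmall r k)
    (hdom : EndpointDominates r k) (δ : ℝ≥0) :
    recoveryError linearMaps r k δ ≤ pointModulus r k (-1) δ := by
  refine ENNReal.le_of_forall_pos_le_add fun ε hε hfin => ?_
  set M := (pointModulus r k (-1) δ).toReal with hM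
  have hM0 : 0 ≤ M := ENNReal.toReal_nonneg
  have hε' : (0 : ℝ) < ε := hε
  obtain ⟨A, B, hA, hB, hAB, hb⟩ : ∃ A B : ℝ, 0 < A ∧ 0 < B ∧
      A * (δ : ℝ) ^ 2 + B ≤ M ^ 2 + (ε : ℝ) ^ 2 ∧ EndpointBound r k A B := by
    rcases eq_or_ne δ 0 with rfl | hδ
    · obtain ⟨A, hA, hb⟩ := hsmall ((ε : ℝ) ^ 2) (by positivity)
      refine ⟨A, _, hA, by positivity, ?_, hb⟩
      have := sq_nonneg M
      simp only [NNReal.coe_zero]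
      linarith
    · exact exists_endpointBound hk (NNReal.coe_pos.2 (pos_iff_ne_zero.2 hδ)) hM0 (by positivity)
        fun f hf h0 h1 => abs_D_le_pointModulus hfin hf h0 h1
  obtain ⟨S, hS, hSδ⟩ := exists_linear_recovery hk hA.le hB.le (hdom A B hA hB hb)
  calc recoveryError linearMaps r k δ ≤ recoveryErrorOf r k δ S := iInf₂_le S hS
    _ ≤ ENNReal.ofReal √(A * (δ : ℝ) ^ 2 + B) := hSδ δ
    _ ≤ ENNReal.ofReal (M + ε) := by
      refine ENNReal.ofReal_le_ofReal (sqrt_le_iff.2 ⟨by positivity, hAB.trans ?_⟩)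
      have := mul_nonneg hM0 hε'.le
      linarith
    _ = pointModulus r k (-1) δ + ε := by
      rw [ENNReal.ofReal_add hM0 hε'.le, hM, ENNReal.ofReal_toReal hfin.ne,
        ENNReal.ofReal_coe_nnreal]

end LandauKolmogorov

end

theorem mainTheorem7 (r k : ℕ) (hrk : (r = 1 ∧ k = 0) ∨ (r = 2 ∧ (k = 0 ∨ k = 1)))
    (R : Set (LandauKolmogorov.LI 2 → LandauKolmogorov.LI ∞))
    (hR : R = LandauKolmogorov.linearMaps ∨ R = LandauKolmogorov.allMaps) (δ : ℝ≥0) :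
    LandauKolmogorov.modulus r k δ = LandauKolmogorov.recoveryError R r k δ ∧
    LandauKolmogorov.recoveryError R r k δ = LandauKolmogorov.pointModulus r k (-1) δ ∧
    LandauKolmogorov.pointModulus r k (-1) δ < ∞ := by
  open LandauKolmogorov in
  have hk : k < r := by omega
  have hsmall : EndpointSmall r k := by
    rcases hrk with ⟨rfl, rfl⟩ | ⟨rfl, rfl | rfl⟩
    exacts [endpointSmall_value_one, endpointSmall_value, endpointSmall_slope]
  have hdom : EndpointDominates r k := by
    rcases hrk with ⟨rfl, rfl⟩ | ⟨rfl, rfl | rfl⟩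
    exacts [endpointDominates_value_one, endpointDominates_value, endpointDominates_slope]
  have h1 : modulus r k δ ≤ recoveryError R r k δ :=
    le_iInf₂ fun S _ => modulus_le_recoveryErrorOf hk δ S
  have h2 : recoveryError R r k δ ≤ recoveryError linearMaps r k δ := by
    rcases hR with rfl | rfl
    · exact le_rfl
    · exact biInf_mono fun _ _ => Set.mem_univ _
  have h3 := recoveryError_linear_le_pointModulus hk hsmall hdom δ
  have h4 := pointModulus_le_modulus hk (t := -1) (by simp) δ
  exact ⟨le_antisymm h1 (h2.trans (h3.trans h4)), le_antisymm (h2.trans h3) (h4.trans h1),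
    pointModulus_lt_top hsmall δ⟩
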